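/- Let $\mathcal H$ be a complex Hilbert space with a complete orthonormal system $(|n\rangle)_{n\in\mathbb N}$, $\mathbb N=\{0,1,2,\dots\}$, and let $\lambda,t>0$. For $m,n\in\mathbb N$ put $$p^{\mathrm{pc}}(m|n)=\binom nm(1-e^{-\lambda t})^m e^{-\lambda t(n-m)},\qquad M^{\mathrm{pc}}_m=\sum_{n\ge0}\sqrt{p^{\mathrm{pc}}(m|n+m)}\,|n\rangle\langle n+m|,$$ $$p^{\mathrm{qc}}(m|n)=\binom{n+m}m(e^{\lambda t}-1)^m e^{-\lambda t(n+m+1)},\qquad M^{\mathrm{qc}}_m=\sum_{n\ge0}\sqrt{p^{\mathrm{qc}}(m|n)}\,|n+m\rangle\langle n|,$$ and let $\mathcal I^{\mathrm{pc}}$ (photon counting) and $\mathcal I^{\mathrm{qc}}$ (quantum counter) be the instruments $\mathcal I_B(b)=\sum_{m\in B}M_m^*\,b\,M_m$ for $B\subseteq\mathbb N$ and bounded operators $b$ on $\mathcal H$ (sums of operators are in the weak operator topology). For each of them let $E_\infty$ be its infinite composition, that is, the unique positive-operator valued measure (POVM) on $\mathbb N^\infty$ with the product $\sigma$-algebra such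 that $$E_\infty(B_1\times\cdots\times B_k\times\mathbb N^\infty)=\mathcal I_{B_1}\circ\cdots\circ\mathcal I_{B_k}(I)\qquad(k\ge1,\ B_1,\dots,B_k\subseteq\mathbb N).$$ Such a POVM exists and is unique in both cases; denote it by $E^{\mathrm{pc}}_\infty$ and $E^{\mathrm{qc}}_\infty$ respectively. A property holds $E_\infty$-almost surely if it holds outside some measurable set $N$ with $E_\infty(N)=O$. Let $E^N(B)=\sum_{n\in B}|n\rangle\langle n|$ for $B\subseteq\mathbb N$, and let $E^X(B)=\int_B F_x\,dx$ (weak integral) with $F_x=\sum_{n\ge0}\frac{e^{-x}x^n}{n!}|n\rangle\langle n|$ for Borel $B\subseteq\mathbb R_+=(0,\infty)$. For $(m_1,m_2,\dots)\in\mathbb N^\infty$ put $M_k=m_1+\cdots+m_k$ and $X_k=e^{-\lambda tk}(m_1+\cdots+m_k)$. (i) $M_k$ converges (to a finite limit) $E^{\mathrm{pc}}_\infty$-almost surely as $k\to\infty$, and the POVM $B\mapsto E^{\mathrm{pc}}_\infty(\lim_k M_k\in B)$ on $\mathbb N$ corresponding to the distribution of the limit equals the photon number observable $E^N$. (ii)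 $X_k$ converges $E^{\mathrm{qc}}_\infty$-almost surely as $k\to\infty$; the limit lies in $\mathbb R_+$ $E^{\mathrm{qc}}_\infty$-almost surely, and the POVM $B\mapsto E^{\mathrm{qc}}_\infty(\lim_k X_k\in B)$ on $\mathbb R_+$ corresponding to the distribution of the limit equals $E^X$. -/

import Mathlib

open Filter Topology MeasureTheory
open scoped InnerProductSpace

noncomputable section

namespace PhotonPOVM

section General

variable {H : Type*} [NormedAddCommGroup H] [InnerProductSpace ℂ H] [CompleteSpace H]

/-- The bounded operators on `H`, with the weak operator topology. All infinite sums of operators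
below are taken in this topology. -/
abbrev Op (H : Type*) [NormedAddCommGroup H] [InnerProductSpace ℂ H] [CompleteSpace H] : Type _ :=
  H →WOT[ℂ] H

/-- The operator `|u⟩⟨v|`, that is `w ↦ ⟪v, w⟫ u`. -/
def ketBra (u v : H) : Op H :=
  ContinuousLinearMapWOT.ofCLM (InnerProductSpace.rankOne ℂ u v)

/-- A positive-operator valued measure on `Ω`: an operator valued measure, countably additive in
the weak operator topology, with positive values and total mass the identity operator.
(As for every `VectorMeasure`, non-measurable sets are given the value `0` by convention.) -/
structure POVM (Ω : Type*) [MeasurableSpace Ω] (H : Type*) [NormedAddCommGroup H]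
    [InnerProductSpace ℂ H] [CompleteSpace H] extends VectorMeasure Ω (Op H) where
  isPositive' : ∀ B : Set Ω, MeasurableSet B → (measureOf' B).toCLM.IsPositive
  univ' : measureOf' Set.univ = 1

namespace POVM

variable {Ω Ω' : Type*} [MeasurableSpace Ω] [MeasurableSpace Ω']

instance : CoeFun (POVM Ω H) (fun _ => Set Ω → Op H) :=
  ⟨fun E => E.toVectorMeasure⟩

/-- A property of outcomes holds `E`-almost surely if it holds outside an `E`-null set, i.e.
outside a measurable set `N` with `E N = 0`. -/
def AlmostSurely (E : POVM Ω H) (P : Ω → Prop) : Prop :=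
  ∃ N : Set Ω, MeasurableSet N ∧ E N = 0 ∧ ∀ ω, ω ∉ N → P ω

/-- The POVM corresponding to the distribution of a random variable `f` under `E`:
`B ↦ E (f ⁻¹' B)`. -/
def map (E : POVM Ω H) (f : Ω → Ω') (hf : Measurable f) : POVM Ω' H where
  toVectorMeasure := E.toVectorMeasure.map f
  isPositive' B hB := by
    have : E.toVectorMeasure.map f B = E (f ⁻¹' B) := VectorMeasure.map_apply _ hf hB
    change (E.toVectorMeasure.map f B).toCLM.IsPositive
    rw [this]
    exact E.isPositive' _ (hf hB)
  univ' := by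
    have : E.toVectorMeasure.map f Set.univ = E (f ⁻¹' Set.univ) :=
      VectorMeasure.map_apply _ hf MeasurableSet.univ
    change E.toVectorMeasure.map f Set.univ = 1
    rw [this]
    exact E.univ'

end POVM

/-- A discrete pure CP instrument with outcome space `ℕ`, given by its measurement operators
`M_m`, which satisfy `∑ M_m* M_m = 1`. -/
structure PureInstrument (H : Type*) [NormedAddCommGroup H]
    [InnerProductSpace ℂ H] [CompleteSpace H] where
  op : ℕ → Op H
  normalized : HasSum (fun m => star (op m) * op m) 1

/-- The Heisenberg picture map `I_B (b) = ∑_{m ∈ B} M_m* b M_m` of a discrete pure instrument. -/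
def PureInstrument.map (I : PureInstrument H) (B : Set ℕ) (b : Op H) : Op H :=
  ∑' m : B, star (I.op m) * b * I.op m

/-- `E` is an infinite composition of the instrument `I`:
`E (B₁ × ⋯ × Bₙ × Ω × Ω × ⋯) = I_{B₁} (I_{B₂} (⋯ I_{Bₙ} (1)))`. -/
def IsInfiniteComposition {Ω : Type*} [MeasurableSpace Ω] (I : Set Ω → Op H → Op H)
    (E : POVM (ℕ → Ω) H) : Prop :=
  ∀ (n : ℕ) (B : Fin n → Set Ω), (∀ i, MeasurableSet (B i)) →
    E {ω | ∀ i : Fin n, ω i ∈ B i} = (List.ofFn B).foldr I 1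

/-- `T = ∫ F dμ` in the weak sense. -/
def IsWeakIntegral {Ω : Type*} [MeasurableSpace Ω] (μ : Measure Ω) (F : Ω → Op H) (T : Op H) :
    Prop :=
  ∀ x y : H, Integrable (fun ω => ⟪x, F ω y⟫_ℂ) μ ∧ ⟪x, T y⟫_ℂ = ∫ ω, ⟪x, F ω y⟫_ℂ ∂μ

open Classical in
/-- The weak integral of an operator valued function (`0` if there is none). -/
def weakIntegral {Ω : Type*} [MeasurableSpace Ω] (μ : Measure Ω) (F : Ω → Op H) : Op H :=
  if h : ∃ T, IsWeakIntegral μ F T then h.choose else 0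

/-! Convergence of the operator series and integrals -/

theorem hasSum_iff_inner {ι : Type*} {T : ι → Op H} {S : Op H} :
    HasSum T S ↔ ∀ x y : H, HasSum (fun i => ⟪x, T i y⟫_ℂ) ⟪x, S y⟫_ℂ := by
  have key : ∀ (s : Finset ι) (x y : H),
      ⟪x, (∑ i ∈ s, T i) y⟫_ℂ = ∑ i ∈ s, ⟪x, T i y⟫_ℂ := by
    classical
    intro s x y
    induction s using Finset.induction_on with
    | empty => simp
    | insert a s ha ih => rw [Finset.sum_insert ha, Finset.sum_insert ha, ← ih]; simp
  unfold HasSum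
  rw [ContinuousLinearMapWOT.tendsto_iff_forall_inner_apply_tendsto]
  simp_rw [key]
  exact forall_comm

/-- A bounded sesquilinear form comes from a bounded operator. -/
theorem exists_op_of_form (f : H → H → ℂ) (C : ℝ)
    (add_left : ∀ x x' y, f (x + x') y = f x y + f x' y)
    (smul_left : ∀ (c : ℂ) x y, f (c • x) y = star c * f x y)
    (add_right : ∀ x y y', f x (y + y') = f x y + f x y')
    (smul_right : ∀ (c : ℂ) x y, f x (c • y) = c * f x y)
    (bound : ∀ x y, ‖f x y‖ ≤ C * ‖x‖ * ‖y‖) :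
    ∃ T : Op H, ∀ x y, ⟪x, T y⟫_ℂ = f x y := by
  let B : H →L⋆[ℂ] H →L[ℂ] ℂ := LinearMap.mkContinuous₂
    (LinearMap.mk₂'ₛₗ (starRingEnd ℂ) (RingHom.id ℂ) f add_left smul_left add_right smul_right)
    C bound
  refine ⟨ContinuousLinearMapWOT.ofCLM
    (ContinuousLinearMap.adjoint (InnerProductSpace.continuousLinearMapOfBilin B)), fun x y => ?_⟩
  rw [ContinuousLinearMapWOT.ofCLM_apply, ContinuousLinearMap.adjoint_inner_right,
    InnerProductSpace.continuousLinearMapOfBilin_apply]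
  rfl

theorem summable_of_bound {ι : Type*} (T : ι → Op H) (C : ℝ)
    (h : ∀ (x y : H) (s : Finset ι), ∑ i ∈ s, ‖⟪x, T i y⟫_ℂ‖ ≤ C * ‖x‖ * ‖y‖) : Summable T := by
  have hn : ∀ x y : H, Summable fun i => ‖⟪x, T i y⟫_ℂ‖ := fun x y =>
    summable_of_sum_le (fun _ => norm_nonneg _) (h x y)
  have hs : ∀ x y : H, Summable fun i => ⟪x, T i y⟫_ℂ := fun x y => (hn x y).of_norm
  obtain ⟨S, hS⟩ := exists_op_of_form (fun x y => ∑' i, ⟪x, T i y⟫_ℂ) C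
    (fun x x' y => by simp_rw [inner_add_left]; exact (hs x y).tsum_add (hs x' y))
    (fun c x y => by simp_rw [inner_smul_left]; exact tsum_mul_left)
    (fun x y y' => by simp_rw [_root_.map_add, inner_add_right]; exact (hs x y).tsum_add (hs x y'))
    (fun c x y => by simp_rw [map_smul, inner_smul_right]; exact tsum_mul_left)
    (fun x y => (norm_tsum_le_tsum_norm (hn x y)).trans ((hn x y).tsum_le_of_sum_le (h x y)))
  exact ⟨S, hasSum_iff_inner.2 fun x y => by rw [hS]; exact (hs x y).hasSum⟩

theorem sum_inner_mul_inner_le {ι : Type*} {u v : ι → H} (hu : Orthonormal ℂ u)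
    (hv : Orthonormal ℂ v) (x y : H) (s : Finset ι) :
    ∑ i ∈ s, ‖⟪x, u i⟫_ℂ‖ * ‖⟪v i, y⟫_ℂ‖ ≤ ‖x‖ * ‖y‖ := by
  refine (Real.sum_mul_le_sqrt_mul_sqrt s _ _).trans ?_
  gcongr
  · refine Real.sqrt_le_iff.2 ⟨norm_nonneg _, ?_⟩
    simp_rw [norm_inner_symm x]
    exact hu.sum_inner_products_le x
  · exact Real.sqrt_le_iff.2 ⟨norm_nonneg _, hv.sum_inner_products_le y⟩

@[simp] theorem inner_ketBra (u v x y : H) : ⟪x, ketBra u v y⟫_ℂ = ⟪x, u⟫_ℂ * ⟪v, y⟫_ℂ := by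
  simp [ketBra, mul_comm]

/-- `∑ c_n |u_n⟩⟨v_n|` converges for orthonormal `u`, `v` and bounded `c`. -/
theorem summable_ketBra {ι : Type*} {u v : ι → H} (hu : Orthonormal ℂ u) (hv : Orthonormal ℂ v)
    (c : ι → ℂ) (hc : ∀ n, ‖c n‖ ≤ 1) : Summable fun n => c n • ketBra (u n) (v n) := by
  refine summable_of_bound _ 1 fun x y s => ?_
  rw [one_mul]
  refine le_trans (Finset.sum_le_sum fun i _ => ?_) (sum_inner_mul_inner_le hu hv x y s)
  simp only [ContinuousLinearMapWOT.smul_apply, inner_smul_right, inner_ketBra, norm_mul]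
  exact mul_le_of_le_one_left (by positivity) (hc i)

theorem hasSum_inner_ketBra {ι : Type*} {u v : ι → H} (hu : Orthonormal ℂ u)
    (hv : Orthonormal ℂ v) (c : ι → ℂ) (hc : ∀ n, ‖c n‖ ≤ 1) (x y : H) :
    HasSum (fun n => c n * (⟪x, u n⟫_ℂ * ⟪v n, y⟫_ℂ))
      ⟪x, (∑' n, c n • ketBra (u n) (v n)) y⟫_ℂ := by
  have := hasSum_iff_inner.1 (summable_ketBra hu hv c hc).hasSum x y
  simpa [inner_smul_right] using this

theorem inner_star_mul (A B : Op H) (x y : H) : ⟪x, (star A * B) y⟫_ℂ = ⟪A x, B y⟫_ℂ := by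
  rw [ContinuousLinearMapWOT.mul_apply, ContinuousLinearMapWOT.star_apply,
    ContinuousLinearMap.star_eq_adjoint, ContinuousLinearMap.adjoint_inner_right]
  rfl

theorem hasSum_inner_star_mul_self {ι : Type*} {u v : ι → H} (hu : Orthonormal ℂ u)
    (hv : Orthonormal ℂ v) (c : ι → ℂ) (hc : ∀ n, ‖c n‖ ≤ 1) (x y : H) :
    HasSum (fun n => (‖c n‖ ^ 2 : ℝ) * (⟪x, v n⟫_ℂ * ⟪v n, y⟫_ℂ))
      ⟪x, (star (∑' n, c n • ketBra (u n) (v n)) * ∑' n, c n • ketBra (u n) (v n)) y⟫_ℂ := by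
  classical
  set W := ∑' n, c n • ketBra (u n) (v n) with hW
  have h1 : ∀ k z, ⟪u k, W z⟫_ℂ = c k * ⟪v k, z⟫_ℂ := by
    intro k z
    have h := hasSum_inner_ketBra hu hv c hc (u k) z
    rw [← hW] at h
    refine h.unique ?_
    convert hasSum_ite_eq k (c k * ⟪v k, z⟫_ℂ) using 2 with n
    rw [orthonormal_iff_ite.1 hu k n]
    by_cases hk : n = k
    · simp [hk]
    · simp [hk, Ne.symm hk]
  rw [inner_star_mul]
  have h := hasSum_inner_ketBra hu hv c hc (W x) y
  rw [← hW] at h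
  convert h using 2 with n
  rw [← inner_conj_symm (W x) (u n), h1, _root_.map_mul, inner_conj_symm]
  have : ((‖c n‖ ^ 2 : ℝ) : ℂ) = c n * (starRingEnd ℂ) (c n) := by
    rw [RCLike.mul_conj]; norm_cast
  rw [this]; ring

/-- The series defining the maps of an instrument converges. -/
theorem PureInstrument.hasSum_map (I : PureInstrument H) (B : Set ℕ) (b : Op H) :
    HasSum (fun m : B => star (I.op m) * b * I.op m) (I.map B b) := by
  refine (summable_of_bound _ ‖b.toCLM‖ fun x y s => ?_).hasSum
  have hK : ∀ z : H, ∑ m ∈ s, ‖I.op m z‖ ^ 2 ≤ ‖z‖ ^ 2 := by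
    intro z
    have h := hasSum_iff_inner.1 I.normalized z z
    simp_rw [inner_star_mul] at h
    have h' : HasSum (fun m => ‖I.op m z‖ ^ 2) (‖z‖ ^ 2) := by
      simp only [inner_self_eq_norm_sq_to_K, ContinuousLinearMapWOT.one_apply] at h
      exact_mod_cast h
    have h2 := h'.summable.comp_injective (i := ((↑) : B → ℕ)) Subtype.val_injective
    calc ∑ m ∈ s, ‖I.op m z‖ ^ 2 ≤ ∑' m : B, ‖I.op m z‖ ^ 2 :=
          h2.sum_le_tsum s fun _ _ => by positivity
      _ ≤ ∑' m : ℕ, ‖I.op m z‖ ^ 2 :=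
          h'.summable.tsum_subtype_le (fun m => ‖I.op m z‖ ^ 2) B fun _ => by positivity
      _ = ‖z‖ ^ 2 := h'.tsum_eq
  calc ∑ m ∈ s, ‖⟪x, (star (I.op m) * b * I.op m) y⟫_ℂ‖
      ≤ ∑ m ∈ s, ‖b.toCLM‖ * (‖I.op m x‖ * ‖I.op m y‖) := by
        refine Finset.sum_le_sum fun m _ => ?_
        rw [mul_assoc, inner_star_mul]
        calc ‖⟪I.op m x, b (I.op m y)⟫_ℂ‖ ≤ ‖I.op m x‖ * ‖b.toCLM (I.op m y)‖ :=
              norm_inner_le_norm _ _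
          _ ≤ ‖I.op m x‖ * (‖b.toCLM‖ * ‖I.op m y‖) := by
              gcongr; exact b.toCLM.le_opNorm _
          _ = _ := by ring
    _ = ‖b.toCLM‖ * ∑ m ∈ s, ‖I.op m x‖ * ‖I.op m y‖ := by rw [Finset.mul_sum]
    _ ≤ ‖b.toCLM‖ * (‖x‖ * ‖y‖) := by
        gcongr
        refine (Real.sum_mul_le_sqrt_mul_sqrt s _ _).trans ?_
        gcongr
        · exact Real.sqrt_le_iff.2 ⟨norm_nonneg _, hK x⟩
        · exact Real.sqrt_le_iff.2 ⟨norm_nonneg _, hK y⟩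
    _ = _ := by ring

theorem weakIntegral_unique {Ω : Type*} [MeasurableSpace Ω] {μ : Measure Ω} {F : Ω → Op H}
    {S T : Op H} (hS : IsWeakIntegral μ F S) (hT : IsWeakIntegral μ F T) : S = T := by
  ext y x
  rw [(hS x y).2, (hT x y).2]

theorem isWeakIntegral_weakIntegral {Ω : Type*} [MeasurableSpace Ω] {μ : Measure Ω}
    {F : Ω → Op H} (h : ∃ T, IsWeakIntegral μ F T) : IsWeakIntegral μ F (weakIntegral μ F) := by
  rw [weakIntegral, dif_pos h]
  exact h.choose_spec

theorem hasSum_star_mul_self_of_diagonal (e : HilbertBasis ℕ ℂ H) (K : ℕ → Op H)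
    (p : ℕ → ℕ → ℝ) (hp0 : ∀ m n, 0 ≤ p m n) (hp : ∀ n, HasSum (fun m => p m n) 1)
    (hK : ∀ m x y, HasSum (fun n => (p m n : ℂ) * (⟪x, e n⟫_ℂ * ⟪e n, y⟫_ℂ))
      ⟪x, (star (K m) * K m) y⟫_ℂ) :
    HasSum (fun m => star (K m) * K m) 1 := by
  rw [hasSum_iff_inner]
  intro x y
  have hz : HasSum (fun n => ⟪x, e n⟫_ℂ * ⟪e n, y⟫_ℂ) ⟪x, y⟫_ℂ := e.hasSum_inner_mul_inner x y
  have hzn : Summable fun n => ‖⟪x, e n⟫_ℂ * ⟪e n, y⟫_ℂ‖ := by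
    refine summable_of_sum_le (c := ‖x‖ * ‖y‖) (fun _ => norm_nonneg _) fun s => ?_
    simp_rw [norm_mul]
    exact sum_inner_mul_inner_le e.orthonormal e.orthonormal x y s
  have hG : Summable fun q : ℕ × ℕ => (p q.2 q.1 : ℂ) * (⟪x, e q.1⟫_ℂ * ⟪e q.1, y⟫_ℂ) := by
    refine Summable.of_norm ?_
    have hfib : ∀ n, HasSum (fun m => ‖(p m n : ℂ) * (⟪x, e n⟫_ℂ * ⟪e n, y⟫_ℂ)‖)
        ‖⟪x, e n⟫_ℂ * ⟪e n, y⟫_ℂ‖ := by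
      intro n
      have := (hp n).mul_right ‖⟪x, e n⟫_ℂ * ⟪e n, y⟫_ℂ‖
      rw [one_mul] at this
      convert! this using 2 with m
      rw [norm_mul, Complex.norm_real, Real.norm_of_nonneg (hp0 m n)]
    rw [summable_prod_of_nonneg (fun _ => norm_nonneg _)]
    refine ⟨fun n => (hfib n).summable, ?_⟩
    convert! hzn using 2 with n
    exact (hfib n).tsum_eq
  have h1 : HasSum (fun n => ⟪x, e n⟫_ℂ * ⟪e n, y⟫_ℂ)
      (∑' q : ℕ × ℕ, (p q.2 q.1 : ℂ) * (⟪x, e q.1⟫_ℂ * ⟪e q.1, y⟫_ℂ)) := by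
    refine hG.hasSum.prod_fiberwise fun n => ?_
    have h : HasSum (fun m => (p m n : ℂ)) ((1 : ℝ) : ℂ) := by exact_mod_cast hp n
    have := h.mul_right (⟪x, e n⟫_ℂ * ⟪e n, y⟫_ℂ)
    rwa [Complex.ofReal_one, one_mul] at this
  have h2 := ((Equiv.prodComm ℕ ℕ).hasSum_iff.2 hG.hasSum).prod_fiberwise fun m => hK m x y
  rw [h1.unique hz] at h2
  exact h2

end General

section Photon

/-! Photon counting and quantum counter instruments of a single-mode field with number
eigenbasis `e 0, e 1, …`, coupling constant `lam` and time interval `t`. -/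

variable {H : Type*} [NormedAddCommGroup H] [InnerProductSpace ℂ H] [CompleteSpace H]

/-- The probability to count `m` photons out of `n`. -/
def pcProb (lam t : ℝ) (m n : ℕ) : ℝ :=
  (n.choose m : ℝ) * (1 - Real.exp (-(lam * t))) ^ m * Real.exp (-(lam * t * ((n : ℝ) - m)))

/-- The probability of the count `m` of the quantum counter for `n` initial photons. -/
def qcProb (lam t : ℝ) (m n : ℕ) : ℝ :=
  ((n + m).choose m : ℝ) * (Real.exp (lam * t) - 1) ^ m * Real.exp (-(lam * t * ((n : ℝ) + m + 1)))

theorem pcProb_nonneg {lam t : ℝ} (hlam : 0 < lam) (ht : 0 < t) (m n : ℕ) :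
    0 ≤ pcProb lam t m n := by
  have : 0 ≤ 1 - Real.exp (-(lam * t)) := by
    rw [sub_nonneg, Real.exp_le_one_iff]; nlinarith
  unfold pcProb; positivity

theorem qcProb_nonneg {lam t : ℝ} (hlam : 0 < lam) (ht : 0 < t) (m n : ℕ) :
    0 ≤ qcProb lam t m n := by
  have : 0 ≤ Real.exp (lam * t) - 1 := by
    rw [sub_nonneg, Real.one_le_exp_iff]; positivity
  unfold qcProb; positivity

theorem hasSum_pcProb (lam t : ℝ) (n : ℕ) : HasSum (fun m => pcProb lam t m n) 1 := by
  have h0 : ∀ m ∉ Finset.range (n + 1), pcProb lam t m n = 0 := by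
    intro m hm
    rw [Finset.mem_range, not_lt] at hm
    rw [pcProb, Nat.choose_eq_zero_of_lt (by omega)]; simp
  have hsum := hasSum_sum_of_ne_finset_zero (L := SummationFilter.unconditional ℕ) h0
  suffices hone : ∑ m ∈ Finset.range (n + 1), pcProb lam t m n = 1 by rwa [hone] at hsum
  have h := add_pow (1 - Real.exp (-(lam * t))) (Real.exp (-(lam * t))) n
  rw [sub_add_cancel, one_pow] at h
  refine Eq.trans ?_ h.symm
  refine Finset.sum_congr rfl fun m hm => ?_
  rw [Finset.mem_range] at hm
  rw [pcProb, ← Real.exp_nat_mul, Nat.cast_sub (by omega)]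
  ring_nf

theorem hasSum_qcProb {lam t : ℝ} (hlam : 0 < lam) (ht : 0 < t) (n : ℕ) :
    HasSum (fun m => qcProb lam t m n) 1 := by
  have hs : 0 < lam * t := mul_pos hlam ht
  set r : ℝ := 1 - Real.exp (-(lam * t)) with hr
  have hr1 : ‖r‖ < 1 := by
    have h1 : Real.exp (-(lam * t)) < 1 := by rw [Real.exp_lt_one_iff]; linarith
    have h2 := Real.exp_pos (-(lam * t))
    rw [Real.norm_eq_abs, abs_lt]; constructor <;> linarith
  have h := (hasSum_choose_mul_geometric_of_norm_lt_one n hr1).mul_left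
    (Real.exp (-(lam * t)) ^ (n + 1))
  have h1 : Real.exp (-(lam * t)) ^ (n + 1) * (1 / (1 - r) ^ (n + 1)) = 1 := by
    rw [hr, sub_sub_cancel]; field_simp
  rw [h1] at h
  refine Eq.mp (congrArg (fun f => HasSum f 1) (funext fun m => ?_)) h
  symm
  have h2 : Real.exp (lam * t) - 1 = r * Real.exp (lam * t) := by
    rw [hr, sub_mul, ← Real.exp_add]; simp
  have h3 : Real.exp (-(lam * t * ((n : ℝ) + m + 1)))
      = Real.exp (-(lam * t)) ^ (n + 1) * Real.exp (-(lam * t)) ^ m := by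
    rw [← pow_add, ← Real.exp_nat_mul]; push_cast; ring_nf
  have h4 : Real.exp (lam * t) ^ m * Real.exp (-(lam * t)) ^ m = 1 := by
    rw [← mul_pow, ← Real.exp_add]; simp
  rw [qcProb, h2, h3, mul_pow, add_comm n m, Nat.choose_symm_add]
  linear_combination ((m + n).choose n : ℝ) * r ^ m * Real.exp (-(lam * t)) ^ (n + 1) * h4

theorem norm_sqrt_le_one {a : ℝ} (h1 : a ≤ 1) : ‖((√a : ℝ) : ℂ)‖ ≤ 1 := by
  rw [Complex.norm_real, Real.norm_of_nonneg (Real.sqrt_nonneg _)]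
  exact Real.sqrt_le_one.2 h1

theorem norm_sqrt_sq {a : ℝ} (h0 : 0 ≤ a) : ‖((√a : ℝ) : ℂ)‖ ^ 2 = a := by
  rw [Complex.norm_real, Real.norm_of_nonneg (Real.sqrt_nonneg _), Real.sq_sqrt h0]

/-- `M_m = ∑ₙ √(p(m | n + m)) |n⟩⟨n + m|` for photon counting. -/
def pcOp (e : HilbertBasis ℕ ℂ H) (lam t : ℝ) (m : ℕ) : Op H :=
  ∑' n : ℕ, ((√(pcProb lam t m (n + m)) : ℝ) : ℂ) • ketBra (e n) (e (n + m))

/-- `M_m = ∑ₙ √(p(m | n)) |n + m⟩⟨n|` for the quantum counter. -/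
def qcOp (e : HilbertBasis ℕ ℂ H) (lam t : ℝ) (m : ℕ) : Op H :=
  ∑' n : ℕ, ((√(qcProb lam t m n) : ℝ) : ℂ) • ketBra (e (n + m)) (e n)

theorem orthonormal_shift (e : HilbertBasis ℕ ℂ H) (m : ℕ) :
    Orthonormal ℂ fun n => e (n + m) :=
  e.orthonormal.comp _ (add_left_injective m)

theorem pcProb_le_one {lam t : ℝ} (hlam : 0 < lam) (ht : 0 < t) (m n : ℕ) :
    pcProb lam t m n ≤ 1 :=
  le_hasSum (hasSum_pcProb lam t n) m fun j _ => pcProb_nonneg hlam ht j n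

theorem qcProb_le_one {lam t : ℝ} (hlam : 0 < lam) (ht : 0 < t) (m n : ℕ) :
    qcProb lam t m n ≤ 1 :=
  le_hasSum (hasSum_qcProb hlam ht n) m fun j _ => qcProb_nonneg hlam ht j n

theorem hasSum_pcOp (e : HilbertBasis ℕ ℂ H) {lam t : ℝ} (hlam : 0 < lam) (ht : 0 < t) (m : ℕ) :
    HasSum (fun n : ℕ => ((√(pcProb lam t m (n + m)) : ℝ) : ℂ) • ketBra (e n) (e (n + m)))
      (pcOp e lam t m) :=
  (summable_ketBra e.orthonormal (orthonormal_shift e m) _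
    fun n => norm_sqrt_le_one (pcProb_le_one hlam ht m (n + m))).hasSum

theorem hasSum_qcOp (e : HilbertBasis ℕ ℂ H) {lam t : ℝ} (hlam : 0 < lam) (ht : 0 < t) (m : ℕ) :
    HasSum (fun n : ℕ => ((√(qcProb lam t m n) : ℝ) : ℂ) • ketBra (e (n + m)) (e n))
      (qcOp e lam t m) :=
  (summable_ketBra (orthonormal_shift e m) e.orthonormal _
    fun n => norm_sqrt_le_one (qcProb_le_one hlam ht m n)).hasSum

/-- The photon counting instrument. -/
def photonCounting (e : HilbertBasis ℕ ℂ H) {lam t : ℝ} (hlam : 0 < lam) (ht : 0 < t) :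
    PureInstrument H where
  op := pcOp e lam t
  normalized := by
    refine hasSum_star_mul_self_of_diagonal e _ (pcProb lam t) (pcProb_nonneg hlam ht)
      (hasSum_pcProb lam t) fun m x y => ?_
    have h := hasSum_inner_star_mul_self e.orthonormal (orthonormal_shift e m) _
      (fun n => norm_sqrt_le_one (pcProb_le_one hlam ht m (n + m))) x y
    simp_rw [norm_sqrt_sq (pcProb_nonneg hlam ht m _)] at h
    refine ((add_left_injective m).hasSum_iff ?_).1 h
    intro n hn
    have : n < m := by
      by_contra! hc
      exact hn ⟨n - m, by simp [hc]⟩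
    rw [pcProb, Nat.choose_eq_zero_of_lt this]; simp

/-- The quantum counter instrument. -/
def quantumCounter (e : HilbertBasis ℕ ℂ H) {lam t : ℝ} (hlam : 0 < lam) (ht : 0 < t) :
    PureInstrument H where
  op := qcOp e lam t
  normalized := by
    refine hasSum_star_mul_self_of_diagonal e _ (qcProb lam t) (qcProb_nonneg hlam ht)
      (hasSum_qcProb hlam ht) fun m x y => ?_
    have h := hasSum_inner_star_mul_self (orthonormal_shift e m) e.orthonormal _
      (fun n => norm_sqrt_le_one (qcProb_le_one hlam ht m n)) x y
    simp_rw [norm_sqrt_sq (qcProb_nonneg hlam ht m _)] at h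
    exact h

/-! The photon number observable and the limit observable of the quantum counter -/

theorem isPositive_of_inner {T : Op H} (h : ∀ x : H, ∃ r : ℝ, 0 ≤ r ∧ ⟪x, T x⟫_ℂ = r) :
    T.toCLM.IsPositive := by
  rw [ContinuousLinearMap.isPositive_iff_complex]
  intro x
  obtain ⟨r, hr, hx⟩ := h x
  rw [ContinuousLinearMapWOT.toCLM_apply, ← inner_conj_symm, hx]
  simp [hr]

theorem hasSum_number (e : HilbertBasis ℕ ℂ H) (B : Set ℕ) (x y : H) :
    HasSum (fun n : B => ⟪x, e n⟫_ℂ * ⟪e n, y⟫_ℂ) ⟪x, (∑' n : B, ketBra (e n) (e n)) y⟫_ℂ := by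
  have ho : Orthonormal ℂ fun n : B => e n := e.orthonormal.comp _ Subtype.val_injective
  simpa using hasSum_inner_ketBra ho ho (fun _ => 1) (by simp) x y

/-- The photon number observable `B ↦ ∑_{n ∈ B} |n⟩⟨n|`. -/
def numberPOVM (e : HilbertBasis ℕ ℂ H) : POVM ℕ H where
  measureOf' B := ∑' n : B, ketBra (e n) (e n)
  empty' := by simp
  not_measurable' B hB := absurd MeasurableSet.of_discrete hB
  m_iUnion' B _ hd := by
    refine hasSum_iff_inner.2 fun x y => ?_
    have h := hasSum_number e (⋃ i, B i) x y
    exact ((Set.unionEqSigmaOfDisjoint hd).symm.hasSum_iff.2 h).sigma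
      fun i => hasSum_number e (B i) x y
  isPositive' B _ := by
    refine isPositive_of_inner fun x => ?_
    have h := hasSum_number e B x x
    have hr : ∀ n : B, ⟪x, e n⟫_ℂ * ⟪e n, x⟫_ℂ = ((‖⟪x, e n⟫_ℂ‖ ^ 2 : ℝ) : ℂ) := fun n => by
      rw [← inner_conj_symm (e n) x, RCLike.mul_conj]; norm_cast
    simp_rw [hr] at h
    refine ⟨∑' n : B, ‖⟪x, e n⟫_ℂ‖ ^ 2, tsum_nonneg fun _ => by positivity, ?_⟩
    rw [Complex.ofReal_tsum]
    exact h.tsum_eq.symm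
  univ' := by
    ext y x
    have h := hasSum_number e Set.univ x y
    exact h.unique ((Equiv.Set.univ ℕ).hasSum_iff.2 (e.hasSum_inner_mul_inner x y))

/-- `F_x = ∑ₙ (e^{-x} xⁿ / n!) |n⟩⟨n|`. -/
def poissonOp (e : HilbertBasis ℕ ℂ H) (x : ℝ) : Op H :=
  ∑' n : ℕ, ((Real.exp (-x) * x ^ n / n.factorial : ℝ) : ℂ) • ketBra (e n) (e n)

theorem poisson_nonneg {x : ℝ} (hx : 0 < x) (n : ℕ) :
    0 ≤ Real.exp (-x) * x ^ n / n.factorial := by positivity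

theorem poisson_le_one {x : ℝ} (hx : 0 < x) (n : ℕ) :
    ‖((Real.exp (-x) * x ^ n / n.factorial : ℝ) : ℂ)‖ ≤ 1 := by
  rw [Complex.norm_real, Real.norm_of_nonneg (poisson_nonneg hx n), mul_div_assoc]
  calc Real.exp (-x) * (x ^ n / n.factorial) ≤ Real.exp (-x) * Real.exp x := by
        gcongr; exact Real.pow_div_factorial_le_exp x hx.le n
    _ = 1 := by rw [← Real.exp_add]; simp

theorem hasSum_poissonOp (e : HilbertBasis ℕ ℂ H) {x : ℝ} (hx : 0 < x) :
    HasSum (fun n : ℕ => ((Real.exp (-x) * x ^ n / n.factorial : ℝ) : ℂ) • ketBra (e n) (e n))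
      (poissonOp e x) :=
  (summable_ketBra e.orthonormal e.orthonormal _ (poisson_le_one hx)).hasSum

theorem hasSum_inner_poissonOp (e : HilbertBasis ℕ ℂ H) (φ ψ : H) {x : ℝ} (hx : 0 < x) :
    HasSum (fun n : ℕ => ((Real.exp (-x) * x ^ n / n.factorial : ℝ) : ℂ) *
      (⟪φ, e n⟫_ℂ * ⟪e n, ψ⟫_ℂ)) ⟪φ, poissonOp e x ψ⟫_ℂ :=
  hasSum_inner_ketBra e.orthonormal e.orthonormal _ (poisson_le_one hx) φ ψ

/-- Lebesgue measure on the half-line `(0, ∞)`. -/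
def halfLine : Measure (Set.Ioi (0 : ℝ)) := Measure.comap Subtype.val volume

theorem lintegral_poisson (n : ℕ) :
    ∫⁻ x : Set.Ioi (0 : ℝ), ENNReal.ofReal (Real.exp (-(x : ℝ)) * (x : ℝ) ^ n / n.factorial)
      ∂halfLine = 1 := by
  have h1 := Real.Gamma_nat_eq_factorial n
  have hpos : (0 : ℝ) < n + 1 := by positivity
  have hint := Real.GammaIntegral_convergent hpos
  rw [Real.Gamma_eq_integral hpos] at h1
  simp only [add_sub_cancel_right, Real.rpow_natCast] at h1 hint
  rw [halfLine, lintegral_subtype_comap measurableSet_Ioi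
    (fun x : ℝ => ENNReal.ofReal (Real.exp (-x) * x ^ n / n.factorial)),
    ← ofReal_integral_eq_lintegral_ofReal (hint.div_const _), integral_div, h1, div_self,
    ENNReal.ofReal_one]
  · positivity
  · filter_upwards [ae_restrict_mem measurableSet_Ioi] with x hx
    exact poisson_nonneg hx n

theorem lintegral_poissonOp_le (e : HilbertBasis ℕ ℂ H) (φ ψ : H) :
    ∫⁻ x : Set.Ioi (0 : ℝ), ‖⟪φ, poissonOp e x ψ⟫_ℂ‖ₑ ∂halfLine ≤ ENNReal.ofReal (‖φ‖ * ‖ψ‖) := by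
  have hz : ∀ s : Finset ℕ, ∑ n ∈ s, ‖⟪φ, e n⟫_ℂ * ⟪e n, ψ⟫_ℂ‖ ≤ ‖φ‖ * ‖ψ‖ := fun s => by
    simp_rw [norm_mul]
    exact sum_inner_mul_inner_le e.orthonormal e.orthonormal φ ψ s
  calc ∫⁻ x : Set.Ioi (0 : ℝ), ‖⟪φ, poissonOp e x ψ⟫_ℂ‖ₑ ∂halfLine
      ≤ ∫⁻ x : Set.Ioi (0 : ℝ), ∑' n : ℕ,
          ENNReal.ofReal (Real.exp (-(x : ℝ)) * (x : ℝ) ^ n / n.factorial) *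
            ‖⟪φ, e n⟫_ℂ * ⟪e n, ψ⟫_ℂ‖ₑ ∂halfLine := by
        refine lintegral_mono fun x => ?_
        rw [← (hasSum_inner_poissonOp e φ ψ x.2).tsum_eq]
        refine enorm_tsum_le_tsum_enorm.trans (ENNReal.tsum_le_tsum fun n => ?_)
        rw [enorm_mul, ← ofReal_norm ((_ : ℝ) : ℂ), Complex.norm_real,
          Real.norm_of_nonneg (poisson_nonneg x.2 n)]
    _ = ∑' n : ℕ, ‖⟪φ, e n⟫_ℂ * ⟪e n, ψ⟫_ℂ‖ₑ := by
        rw [lintegral_tsum fun n => by fun_prop]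
        refine tsum_congr fun n => ?_
        rw [lintegral_mul_const _ (by fun_prop), lintegral_poisson, one_mul]
    _ ≤ ENNReal.ofReal (‖φ‖ * ‖ψ‖) := by
        refine ENNReal.summable.tsum_le_of_sum_le fun s => ?_
        simp_rw [← ofReal_norm]
        rw [← ENNReal.ofReal_sum_of_nonneg fun _ _ => norm_nonneg _]
        exact ENNReal.ofReal_le_ofReal (hz s)

theorem integrable_poissonOp (e : HilbertBasis ℕ ℂ H) (φ ψ : H) :
    Integrable (fun x : Set.Ioi (0 : ℝ) => ⟪φ, poissonOp e x ψ⟫_ℂ) halfLine := by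
  refine ⟨?_, (lintegral_poissonOp_le e φ ψ).trans_lt ENNReal.ofReal_lt_top⟩
  refine aestronglyMeasurable_of_tendsto_ae atTop
    (f := fun (s : Finset ℕ) (x : Set.Ioi (0 : ℝ)) => ∑ n ∈ s,
      ((Real.exp (-(x : ℝ)) * (x : ℝ) ^ n / n.factorial : ℝ) : ℂ) *
        (⟪φ, e n⟫_ℂ * ⟪e n, ψ⟫_ℂ)) (fun s => ?_) (ae_of_all _ fun x => ?_)
  · exact Continuous.aestronglyMeasurable (by fun_prop)
  · exact hasSum_inner_poissonOp e φ ψ x.2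

theorem integral_poissonOp (e : HilbertBasis ℕ ℂ H) (φ ψ : H) :
    ∫ x : Set.Ioi (0 : ℝ), ⟪φ, poissonOp e x ψ⟫_ℂ ∂halfLine = ⟪φ, ψ⟫_ℂ := by
  have hz : Summable fun n => ‖⟪φ, e n⟫_ℂ * ⟪e n, ψ⟫_ℂ‖ := by
    refine summable_of_sum_le (c := ‖φ‖ * ‖ψ‖) (fun _ => norm_nonneg _) fun s => ?_
    simp_rw [norm_mul]
    exact sum_inner_mul_inner_le e.orthonormal e.orthonormal φ ψ s
  have hnn : ∀ n : ℕ, 0 ≤ᵐ[halfLine] fun x : Set.Ioi (0 : ℝ) =>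
      Real.exp (-(x : ℝ)) * (x : ℝ) ^ n / n.factorial := fun n =>
    ae_of_all _ fun x => poisson_nonneg x.2 n
  have hmeas : ∀ n : ℕ, Measurable fun x : Set.Ioi (0 : ℝ) =>
      Real.exp (-(x : ℝ)) * (x : ℝ) ^ n / n.factorial := fun n => by fun_prop
  have hw : ∀ n : ℕ, Integrable (fun x : Set.Ioi (0 : ℝ) =>
      Real.exp (-(x : ℝ)) * (x : ℝ) ^ n / n.factorial) halfLine := fun n => by
    refine ⟨(hmeas n).aestronglyMeasurable, ?_⟩
    rw [hasFiniteIntegral_iff_ofReal (hnn n), lintegral_poisson]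
    exact ENNReal.one_lt_top
  have hw1 : ∀ n : ℕ, ∫ x : Set.Ioi (0 : ℝ),
      Real.exp (-(x : ℝ)) * (x : ℝ) ^ n / n.factorial ∂halfLine = 1 := fun n => by
    rw [integral_eq_lintegral_of_nonneg_ae (hnn n) (hmeas n).aestronglyMeasurable,
      lintegral_poisson, ENNReal.toReal_one]
  have h := hasSum_integral_of_summable_integral_norm (μ := halfLine)
    (F := fun (n : ℕ) (x : Set.Ioi (0 : ℝ)) =>
      ((Real.exp (-(x : ℝ)) * (x : ℝ) ^ n / n.factorial : ℝ) : ℂ) * (⟪φ, e n⟫_ℂ * ⟪e n, ψ⟫_ℂ))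
    (fun n => (hw n).ofReal.mul_const _) (by
      refine hz.congr fun n => ?_
      simp_rw [norm_mul ((_ : ℝ) : ℂ), integral_mul_const, Complex.norm_real]
      rw [integral_congr_ae ((hnn n).mono fun x hx => Real.norm_of_nonneg hx), hw1, one_mul])
  simp_rw [integral_mul_const, integral_complex_ofReal, hw1, Complex.ofReal_one, one_mul] at h
  rw [h.unique (e.hasSum_inner_mul_inner φ ψ) |>.symm]
  exact integral_congr_ae (ae_of_all _ fun x => (hasSum_inner_poissonOp e φ ψ x.2).tsum_eq.symm)

theorem isWeakIntegral_poissonOp (e : HilbertBasis ℕ ℂ H) (B : Set (Set.Ioi (0 : ℝ))) :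
    IsWeakIntegral (halfLine.restrict B) (fun x => poissonOp e x)
      (weakIntegral (halfLine.restrict B) fun x => poissonOp e x) := by
  apply isWeakIntegral_weakIntegral
  have hi : ∀ φ ψ : H, Integrable (fun x : Set.Ioi (0 : ℝ) => ⟪φ, poissonOp e x ψ⟫_ℂ)
      (halfLine.restrict B) := fun φ ψ => (integrable_poissonOp e φ ψ).restrict
  obtain ⟨T, hT⟩ := exists_op_of_form
    (fun φ ψ => ∫ x, ⟪φ, poissonOp e (x : Set.Ioi (0 : ℝ)) ψ⟫_ℂ ∂halfLine.restrict B) 1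
    (fun φ φ' ψ => by simp_rw [inner_add_left]; exact integral_add (hi φ ψ) (hi φ' ψ))
    (fun c φ ψ => by simp_rw [inner_smul_left]; exact integral_const_mul _ _)
    (fun φ ψ ψ' => by
      simp_rw [_root_.map_add, inner_add_right]; exact integral_add (hi φ ψ) (hi φ ψ'))
    (fun c φ ψ => by simp_rw [map_smul, inner_smul_right]; exact integral_const_mul _ _)
    (fun φ ψ => by
      rw [one_mul]
      refine (ENNReal.ofReal_le_ofReal_iff (by positivity)).1 ?_
      rw [ofReal_norm]
      refine (enorm_integral_le_lintegral_enorm _).trans ?_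
      exact (lintegral_mono' Measure.restrict_le_self le_rfl).trans (lintegral_poissonOp_le e φ ψ))
  exact ⟨T, fun φ ψ => ⟨hi φ ψ, hT φ ψ⟩⟩

theorem inner_poissonOp_self (e : HilbertBasis ℕ ℂ H) (φ : H) {x : ℝ} (hx : 0 < x) :
    ∃ r : ℝ, 0 ≤ r ∧ ⟪φ, poissonOp e x φ⟫_ℂ = r := by
  have h := hasSum_inner_poissonOp e φ φ hx
  have hr : ∀ n : ℕ, ((Real.exp (-x) * x ^ n / n.factorial : ℝ) : ℂ) *
      (⟪φ, e n⟫_ℂ * ⟪e n, φ⟫_ℂ) =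
      ((Real.exp (-x) * x ^ n / n.factorial * ‖⟪φ, e n⟫_ℂ‖ ^ 2 : ℝ) : ℂ) := fun n => by
    rw [← inner_conj_symm (e n) φ, RCLike.mul_conj]; push_cast; rfl
  simp_rw [hr] at h
  refine ⟨∑' n : ℕ, Real.exp (-x) * x ^ n / n.factorial * ‖⟪φ, e n⟫_ℂ‖ ^ 2,
    tsum_nonneg fun _ => by positivity, ?_⟩
  rw [Complex.ofReal_tsum]
  exact h.tsum_eq.symm

open Classical in
/-- The POVM `B ↦ ∫_B F_x dx` on the half-line `(0, ∞)`. -/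
def poissonPOVM (e : HilbertBasis ℕ ℂ H) : POVM (Set.Ioi (0 : ℝ)) H where
  measureOf' B :=
    if MeasurableSet B then weakIntegral (halfLine.restrict B) fun x => poissonOp e x else 0
  empty' := by
    rw [if_pos MeasurableSet.empty]
    ext y x
    rw [(isWeakIntegral_poissonOp e ∅ x y).2]; simp
  not_measurable' B hB := if_neg hB
  m_iUnion' B hB hd := by
    rw [if_pos (MeasurableSet.iUnion hB)]
    simp_rw [if_pos (hB _)]
    refine hasSum_iff_inner.2 fun x y => ?_
    simp_rw [fun B => (isWeakIntegral_poissonOp e B x y).2]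
    exact hasSum_integral_iUnion hB hd (integrable_poissonOp e x y).integrableOn
  isPositive' B hB := by
    rw [if_pos hB]
    refine isPositive_of_inner fun φ => ?_
    rw [(isWeakIntegral_poissonOp e B φ φ).2]
    choose r hr0 hr using fun x : Set.Ioi (0 : ℝ) => inner_poissonOp_self e φ x.2
    simp_rw [hr]
    exact ⟨∫ x in B, r x ∂halfLine, integral_nonneg hr0, integral_complex_ofReal⟩
  univ' := by
    rw [if_pos MeasurableSet.univ]
    ext y x
    rw [(isWeakIntegral_poissonOp e Set.univ x y).2, Measure.restrict_univ, integral_poissonOp]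
    rfl

end Photon

/-- The total count `M_k = m_1 + ⋯ + m_k` (outcomes are indexed from `0`). -/
def totalCount (k : ℕ) (m : ℕ → ℕ) : ℕ := ∑ i ∈ Finset.range k, m i

/-- The normalized count `X_k = e^{-λ t k} (m_1 + ⋯ + m_k)`. -/
def normalizedCount (lam t : ℝ) (k : ℕ) (m : ℕ → ℕ) : ℝ :=
  Real.exp (-(lam * t * k)) * totalCount k m

end PhotonPOVM

end

open PhotonPOVM

/-! In the number basis both instruments act by weighted shifts: `M_m` sends `|n⟩` to `√(p(m|n))`
times another basis vector. Conjugation by `M_m` therefore keeps diagonal operators diagonal, and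
the infinite composition has the form `∑ₙ μₙ(B) |n⟩⟨n|`, where `μₙ` is the law of the outcomes of a
classical Markov chain started at `n`. Existence reduces to exhibiting probability measures `μₙ`
with the one-step Markov identity (`isInfiniteComposition_diagPOVM`); uniqueness is a π-system
argument. An almost sure property of a diagonal POVM is one that holds `μₙ`-almost surely for every
`n` (`diagPOVM_almostSurely_iff`), so only classical limit theorems remain.

Photon counting: each of the `n` photons is absorbed independently, at a geometrically distributed
time (`pcLaw_markov`). All of them are absorbed eventually, so the total count ends at `n`, the
limit law is the Dirac mass at `n`, and the diagonal POVM of these masses is `E^N`.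

Quantum counter, with `s = λt`: the chain is a mixture. Draw `x` with density `e^{-x} xⁿ/n!`, then
independent Poisson counts with means `x e^{si}(e^s - 1)`, `i = 0, 1, …`. The Markov identity
(`qcLaw_markov`) is Gamma–Poisson conjugacy followed by the rescaling `x ↦ x e^s`. Given `x`, the
total count up to `k` has mean and variance `x(e^{sk} - 1)`, so Chebyshev and Borel–Cantelli give
`X_k → x` (`ae_poissonClicks_tendsto`). The limit thus has the Gamma density which is the `n`-th
diagonal entry of `F_x`. -/

namespace PhotonPOVM

/-! ### Diagonal POVMs and their classical laws -/

section Diagonal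

variable {H : Type*} [NormedAddCommGroup H] [InnerProductSpace ℂ H] [CompleteSpace H]

theorem op_ext_of_basis (e : HilbertBasis ℕ ℂ H) {S T : Op H}
    (h : ∀ j k, ⟪e j, S (e k)⟫_ℂ = ⟪e j, T (e k)⟫_ℂ) : S = T := by
  have h1 : ∀ k, S (e k) = T (e k) := fun k => by
    apply e.repr.injective
    ext j
    rw [e.repr_apply_apply, e.repr_apply_apply, h]
  have h2 : S.toCLM = T.toCLM := by
    refine ContinuousLinearMap.ext_on
      ((Submodule.dense_iff_topologicalClosure_eq_top).2 e.dense_span) ?_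
    rintro _ ⟨k, rfl⟩
    exact h1 k
  ext y x
  change ⟪x, S.toCLM y⟫_ℂ = ⟪x, T.toCLM y⟫_ℂ
  rw [h2]

theorem POVM.ext_of_apply {Ω : Type*} [MeasurableSpace Ω] {E F : POVM Ω H}
    (h : ∀ B, MeasurableSet B → E B = F B) : E = F := by
  have hv : E.toVectorMeasure = F.toVectorMeasure := VectorMeasure.ext h
  cases E; cases F; cases hv; rfl

theorem norm_measureReal_le_one {Ω : Type*} [MeasurableSpace Ω] (μ : Measure Ω)
    [IsProbabilityMeasure μ] (B : Set Ω) : ‖((μ.real B : ℝ) : ℂ)‖ ≤ 1 := by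
  rw [Complex.norm_real, Real.norm_of_nonneg measureReal_nonneg]
  exact measureReal_le_one

/-- The operator `∑ₙ μₙ(B) |n⟩⟨n|`. -/
noncomputable def diagOp {Ω : Type*} [MeasurableSpace Ω] (e : HilbertBasis ℕ ℂ H)
    (μ : ℕ → Measure Ω) (B : Set Ω) : Op H :=
  ∑' n, (((μ n).real B : ℝ) : ℂ) • ketBra (e n) (e n)

variable {Ω Ω' : Type*} [MeasurableSpace Ω] [MeasurableSpace Ω']

theorem hasSum_inner_diagOp (e : HilbertBasis ℕ ℂ H) (μ : ℕ → Measure Ω)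
    [∀ n, IsProbabilityMeasure (μ n)] (B : Set Ω) (x y : H) :
    HasSum (fun n => (((μ n).real B : ℝ) : ℂ) * (⟪x, e n⟫_ℂ * ⟪e n, y⟫_ℂ))
      ⟪x, diagOp e μ B y⟫_ℂ :=
  hasSum_inner_ketBra e.orthonormal e.orthonormal _ (fun n => norm_measureReal_le_one (μ n) B) x y

theorem inner_diagOp_basis (e : HilbertBasis ℕ ℂ H) (μ : ℕ → Measure Ω)
    [∀ n, IsProbabilityMeasure (μ n)] (B : Set Ω) (j k : ℕ) :
    ⟪e j, diagOp e μ B (e k)⟫_ℂ = if j = k then (((μ k).real B : ℝ) : ℂ) else 0 := by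
  refine (hasSum_inner_diagOp e μ B (e j) (e k)).unique ?_
  have he := orthonormal_iff_ite.1 e.orthonormal
  simp only [he]
  convert! hasSum_single (f := fun n => (((μ n).real B : ℝ) : ℂ) *
    ((if j = n then 1 else 0) * (if n = k then 1 else 0))) j ?_ using 1
  · by_cases h : j = k <;> simp [h]
  · intro n hn
    simp [hn.symm]

/-- The numbers `μₙ(B)` are the diagonal matrix entries. Null sets of the POVM are thus the common
null sets of the laws. -/
theorem diagOp_eq_zero_iff (e : HilbertBasis ℕ ℂ H) (μ : ℕ → Measure Ω)
    [∀ n, IsProbabilityMeasure (μ n)] {B : Set Ω} :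
    diagOp e μ B = 0 ↔ ∀ n, μ n B = 0 := by
  constructor
  · intro h n
    have := inner_diagOp_basis e μ B n n
    rw [h] at this
    rw [if_pos rfl, ContinuousLinearMapWOT.zero_apply, inner_zero_right, eq_comm,
      Complex.ofReal_eq_zero] at this
    exact (measureReal_eq_zero_iff (by finiteness)).1 this
  · intro h
    refine op_ext_of_basis e fun j k => ?_
    rw [inner_diagOp_basis]
    simp [measureReal_def, h]

theorem hasSum_measureReal_iUnion {ι : Type*} [Countable ι] (μ : Measure Ω) [IsFiniteMeasure μ]
    {B : ι → Set Ω} (hB : ∀ i, MeasurableSet (B i)) (hd : Pairwise (Function.onFun Disjoint B)) :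
    HasSum (fun i => μ.real (B i)) (μ.real (⋃ i, B i)) := by
  have h := μ.toSignedMeasure.hasSum_of_disjoint_iUnion hB hd
  simpa only [Measure.toSignedMeasure_apply_measurable (hB _),
    Measure.toSignedMeasure_apply_measurable (MeasurableSet.iUnion hB)] using h

/-- Countable additivity is an exchange of the sums over `n` and `i`. The double series converges
absolutely because `∑ᵢ μₙ(Bᵢ) ≤ 1` and the products of coefficients of `x` and `y` are absolutely
summable. -/
theorem hasSum_diagOp_iUnion (e : HilbertBasis ℕ ℂ H) (μ : ℕ → Measure Ω)
    [∀ n, IsProbabilityMeasure (μ n)] {B : ℕ → Set Ω} (hB : ∀ i, MeasurableSet (B i))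
    (hd : Pairwise (Function.onFun Disjoint B)) :
    HasSum (fun i => diagOp e μ (B i)) (diagOp e μ (⋃ i, B i)) := by
  refine hasSum_iff_inner.2 fun x y => ?_
  have hz : Summable fun n => ‖⟪x, e n⟫_ℂ * ⟪e n, y⟫_ℂ‖ := by
    refine summable_of_sum_le (c := ‖x‖ * ‖y‖) (fun _ => norm_nonneg _) fun s => ?_
    simp_rw [norm_mul]
    exact sum_inner_mul_inner_le e.orthonormal e.orthonormal x y s
  have hU : ∀ n, HasSum (fun i => (μ n).real (B i)) ((μ n).real (⋃ i, B i)) := fun n =>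
    hasSum_measureReal_iUnion (μ n) hB hd
  have hG : Summable fun q : ℕ × ℕ =>
      (((μ q.1).real (B q.2) : ℝ) : ℂ) * (⟪x, e q.1⟫_ℂ * ⟪e q.1, y⟫_ℂ) := by
    refine Summable.of_norm ?_
    have hfib : ∀ n, HasSum
        (fun i => ‖(((μ n).real (B i) : ℝ) : ℂ) * (⟪x, e n⟫_ℂ * ⟪e n, y⟫_ℂ)‖)
        ((μ n).real (⋃ i, B i) * ‖⟪x, e n⟫_ℂ * ⟪e n, y⟫_ℂ‖) := fun n => by
      convert! (hU n).mul_right ‖⟪x, e n⟫_ℂ * ⟪e n, y⟫_ℂ‖ using 2 with i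
      rw [norm_mul, Complex.norm_real, Real.norm_of_nonneg measureReal_nonneg]
    rw [summable_prod_of_nonneg (fun _ => norm_nonneg _)]
    refine ⟨fun n => (hfib n).summable, ?_⟩
    simp_rw [fun n => (hfib n).tsum_eq]
    exact hz.of_nonneg_of_le (fun n => by positivity)
      fun n => mul_le_of_le_one_left (norm_nonneg _) measureReal_le_one
  have h1 : ∑' q : ℕ × ℕ, (((μ q.1).real (B q.2) : ℝ) : ℂ) * (⟪x, e q.1⟫_ℂ * ⟪e q.1, y⟫_ℂ)
      = ⟪x, diagOp e μ (⋃ i, B i) y⟫_ℂ := by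
    have h2 : ∀ n, HasSum (fun i => (((μ n).real (B i) : ℝ) : ℂ) * (⟪x, e n⟫_ℂ * ⟪e n, y⟫_ℂ))
        ((((μ n).real (⋃ i, B i) : ℝ) : ℂ) * (⟪x, e n⟫_ℂ * ⟪e n, y⟫_ℂ)) := fun n =>
      (Complex.hasSum_ofReal.2 (hU n)).mul_right _
    exact (hG.hasSum.prod_fiberwise h2).unique (hasSum_inner_diagOp e μ _ x y)
  rw [← h1]
  exact ((Equiv.prodComm ℕ ℕ).hasSum_iff.2 hG.hasSum).prod_fiberwise
    fun i => hasSum_inner_diagOp e μ (B i) x y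

open Classical in
/-- The POVM `B ↦ ∑ₙ μₙ(B) |n⟩⟨n|` with outcome distribution `μₙ` in the state `|n⟩`. -/
noncomputable def diagPOVM (e : HilbertBasis ℕ ℂ H) (μ : ℕ → Measure Ω)
    [∀ n, IsProbabilityMeasure (μ n)] : POVM Ω H where
  measureOf' B := if MeasurableSet B then diagOp e μ B else 0
  empty' := by
    rw [if_pos MeasurableSet.empty, diagOp_eq_zero_iff]
    simp
  not_measurable' B hB := if_neg hB
  m_iUnion' B hB hd := by
    rw [if_pos (MeasurableSet.iUnion hB)]
    simp_rw [if_pos (hB _)]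
    exact hasSum_diagOp_iUnion e μ hB hd
  isPositive' B hB := by
    rw [if_pos hB]
    refine isPositive_of_inner fun x => ?_
    have h := hasSum_inner_diagOp e μ B x x
    have hr : ∀ n, (((μ n).real B : ℝ) : ℂ) * (⟪x, e n⟫_ℂ * ⟪e n, x⟫_ℂ)
        = (((μ n).real B * ‖⟪x, e n⟫_ℂ‖ ^ 2 : ℝ) : ℂ) := fun n => by
      rw [← inner_conj_symm (e n) x, RCLike.mul_conj]; push_cast; rfl
    simp_rw [hr] at h
    refine ⟨∑' n, (μ n).real B * ‖⟪x, e n⟫_ℂ‖ ^ 2, tsum_nonneg fun _ => by positivity, ?_⟩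
    rw [Complex.ofReal_tsum]
    exact h.tsum_eq.symm
  univ' := by
    rw [if_pos MeasurableSet.univ]
    refine op_ext_of_basis e fun j k => ?_
    rw [inner_diagOp_basis, ContinuousLinearMapWOT.one_apply,
      orthonormal_iff_ite.1 e.orthonormal j k]
    simp

theorem diagPOVM_apply (e : HilbertBasis ℕ ℂ H) (μ : ℕ → Measure Ω)
    [∀ n, IsProbabilityMeasure (μ n)] {B : Set Ω} (hB : MeasurableSet B) :
    diagPOVM e μ B = diagOp e μ B :=
  if_pos hB

/-- The measure `Measure.sum μ` has exactly the common null sets of all `μ n`; its measurable hull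
of the exceptional set serves as the one null set required. -/
theorem diagPOVM_almostSurely_iff (e : HilbertBasis ℕ ℂ H) (μ : ℕ → Measure Ω)
    [∀ n, IsProbabilityMeasure (μ n)] {P : Ω → Prop} :
    (diagPOVM e μ).AlmostSurely P ↔ ∀ n, ∀ᵐ ω ∂μ n, P ω := by
  constructor
  · rintro ⟨N, hN, h0, hP⟩ n
    rw [diagPOVM_apply e μ hN, diagOp_eq_zero_iff] at h0
    exact measure_mono_null (fun ω hω => by_contra fun h => hω (hP ω h)) (h0 n)
  · intro h
    have h' : ∀ᵐ ω ∂Measure.sum μ, P ω := Measure.ae_sum_iff.2 h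
    refine ⟨toMeasurable (Measure.sum μ) {ω | ¬ P ω}, measurableSet_toMeasurable _ _, ?_,
      fun ω hω => by_contra fun hc => hω (subset_toMeasurable _ _ hc)⟩
    have h0 : Measure.sum μ (toMeasurable (Measure.sum μ) {ω | ¬ P ω}) = 0 := by
      rw [measure_toMeasurable]; exact h'
    rw [diagPOVM_apply e μ (measurableSet_toMeasurable _ _), diagOp_eq_zero_iff]
    rwa [Measure.sum_apply_eq_zero] at h0

theorem diagPOVM_map_eq (e : HilbertBasis ℕ ℂ H) (μ : ℕ → Measure Ω) (ν : ℕ → Measure Ω')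
    [∀ n, IsProbabilityMeasure (μ n)] [∀ n, IsProbabilityMeasure (ν n)] {f : Ω → Ω'}
    (hf : Measurable f) (h : ∀ n, (μ n).map f = ν n) :
    (diagPOVM e μ).map f hf = diagPOVM e ν := by
  refine POVM.ext_of_apply fun B hB => ?_
  have : (diagPOVM e μ).map f hf B = diagPOVM e μ (f ⁻¹' B) := VectorMeasure.map_apply _ hf hB
  rw [this, diagPOVM_apply e μ (hf hB), diagPOVM_apply e ν hB, diagOp, diagOp]
  simp_rw [← h, measureReal_def, Measure.map_apply hf hB]

/-- Working with `Measure.sum μ` produces a single limit function valid for all `n` at once. -/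
theorem exists_measurable_limit {X : Type*} [TopologicalSpace X]
    [TopologicalSpace.PseudoMetrizableSpace X] [MeasurableSpace X] [BorelSpace X]
    (μ : ℕ → Measure Ω) (f : ℕ → Ω → X) (hf : ∀ k, Measurable (f k))
    (h : ∀ n, ∀ᵐ ω ∂μ n, ∃ x, Tendsto (fun k => f k ω) atTop (𝓝 x)) :
    ∃ L : Ω → X, Measurable L ∧ ∀ n, ∀ᵐ ω ∂μ n, Tendsto (fun k => f k ω) atTop (𝓝 (L ω)) := by
  obtain ⟨L, hL, h'⟩ := measurable_limit_of_tendsto_metrizable_ae (μ := Measure.sum μ)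
    (L := atTop) (fun k => (hf k).aemeasurable) (Measure.ae_sum_iff.2 h)
  exact ⟨L, hL, Measure.ae_sum_iff.1 h'⟩

end Diagonal

/-! ### Infinite compositions: uniqueness on boxes, and existence from a Markov chain -/

section Boxes

variable {H : Type*} [NormedAddCommGroup H] [InnerProductSpace ℂ H] [CompleteSpace H]
variable {Ω : Type*} [MeasurableSpace Ω]

/-- The sets `B₁ × ⋯ × Bₙ × Ω × Ω × ⋯` with measurable sides. -/
def boxes (Ω : Type*) [MeasurableSpace Ω] : Set (Set (ℕ → Ω)) :=
  {S | ∃ (n : ℕ) (B : Fin n → Set Ω), (∀ i, MeasurableSet (B i)) ∧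
    S = {ω | ∀ i : Fin n, ω i ∈ B i}}

theorem measurableSet_box {n : ℕ} {B : Fin n → Set Ω} (hB : ∀ i, MeasurableSet (B i)) :
    MeasurableSet {ω : ℕ → Ω | ∀ i : Fin n, ω i ∈ B i} := by
  rw [Set.ofPred_forall]
  exact MeasurableSet.iInter fun i => measurable_pi_apply _ (hB i)

theorem isPiSystem_boxes : IsPiSystem (boxes Ω) := by
  rintro _ ⟨n, B, hB, rfl⟩ _ ⟨n', B', hB', rfl⟩ -
  -- The length `n + n'` exceeds every index constrained by either box; missing sides are padded
  -- with `Set.univ`.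
  refine ⟨n + n', fun i => (if h : (i : ℕ) < n then B ⟨i, h⟩ else Set.univ) ∩
    (if h : (i : ℕ) < n' then B' ⟨i, h⟩ else Set.univ), fun i => ?_, ?_⟩
  · refine MeasurableSet.inter ?_ ?_ <;> split_ifs <;> simp [hB, hB']
  · ext ω
    simp only [Set.mem_inter_iff, Set.mem_ofPred_eq]
    constructor
    · rintro ⟨h, h'⟩ i
      constructor
      · split_ifs with hi
        exacts [h ⟨i, hi⟩, trivial]
      · split_ifs with hi
        exacts [h' ⟨i, hi⟩, trivial]
    · intro h
      refine ⟨fun i => ?_, fun i => ?_⟩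
      · have := (h ⟨i, by omega⟩).1
        rwa [dif_pos i.2] at this
      · have := (h ⟨i, by omega⟩).2
        rwa [dif_pos i.2] at this

theorem generateFrom_boxes :
    (MeasurableSpace.pi : MeasurableSpace (ℕ → Ω)) = MeasurableSpace.generateFrom (boxes Ω) := by
  apply le_antisymm
  · refine iSup_le fun i => ?_
    rintro _ ⟨S, hS, rfl⟩
    refine MeasurableSpace.measurableSet_generateFrom
      ⟨i + 1, fun j => if (j : ℕ) = i then S else Set.univ, fun j => ?_, ?_⟩
    · dsimp only
      split_ifs <;> simp [hS]
    · ext ω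
      simp only [Set.mem_preimage, Set.mem_ofPred_eq]
      constructor
      · intro h j
        split_ifs with hj
        · rwa [hj]
        · trivial
      · intro h
        simpa using h ⟨i, by omega⟩
  · refine MeasurableSpace.generateFrom_le ?_
    rintro _ ⟨n, B, hB, rfl⟩
    exact measurableSet_box hB

theorem IsInfiniteComposition.unique {I : Set Ω → Op H → Op H} {E F : POVM (ℕ → Ω) H}
    (hE : IsInfiniteComposition I E) (hF : IsInfiniteComposition I F) : E = F := by
  have h : E.toVectorMeasure = F.toVectorMeasure := by
    refine VectorMeasure.ext_of_generateFrom (boxes Ω) ?_ generateFrom_boxes isPiSystem_boxes ?_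
    · rintro _ ⟨n, B, hB, rfl⟩
      exact (hE n B hB).trans (hF n B hB).symm
    · exact E.univ'.trans F.univ'.symm
  exact POVM.ext_of_apply fun B _ => by rw [h]

/-- Off-diagonal entries vanish because distinct basis vectors of nonzero weight are sent to
distinct ones. Injectivity is asked only where the weights do not vanish, since the truncated
subtraction `n - m` collapses all `n ≤ m`. -/
theorem inner_shift_conj (e : HilbertBasis ℕ ℂ H) (M : Op H) (p : ℕ → ℝ) (hp : ∀ n, 0 ≤ p n)
    (next : ℕ → ℕ) (hM : ∀ n, M (e n) = ((√(p n) : ℝ) : ℂ) • e (next n))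
    (hinj : ∀ j k, p j ≠ 0 → p k ≠ 0 → next j = next k → j = k)
    (μ : ℕ → Measure Ω) [∀ n, IsProbabilityMeasure (μ n)] (B : Set Ω) (j k : ℕ) :
    ⟪e j, (star M * diagOp e μ B * M) (e k)⟫_ℂ =
      if j = k then ((p k * (μ (next k)).real B : ℝ) : ℂ) else 0 := by
  rw [mul_assoc, inner_star_mul, ContinuousLinearMapWOT.mul_apply, hM, hM, map_smul,
    inner_smul_left, inner_smul_right, inner_diagOp_basis, Complex.conj_ofReal]
  by_cases hjk : j = k
  · subst hjk
    rw [if_pos rfl, if_pos rfl, ← mul_assoc, ← Complex.ofReal_mul, Real.mul_self_sqrt (hp j)]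
    push_cast; rfl
  · rw [if_neg hjk]
    by_cases h : p j = 0 ∨ p k = 0
    · rcases h with h | h <;> simp [h]
    · push Not at h
      rw [if_neg fun hn => hjk (hinj j k h.1 h.2 hn)]
      simp

/-- If the measurement operators act as weighted shifts on the number basis, then the infinite
composition is diagonal, with the laws of the associated Markov chain. -/
theorem isInfiniteComposition_diagPOVM (e : HilbertBasis ℕ ℂ H) (I : PureInstrument H)
    (p : ℕ → ℕ → ℝ) (hp : ∀ m n, 0 ≤ p m n) (next : ℕ → ℕ → ℕ)
    (hI : ∀ m n, I.op m (e n) = ((√(p m n) : ℝ) : ℂ) • e (next m n))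
    (hinj : ∀ m j k, p m j ≠ 0 → p m k ≠ 0 → next m j = next m k → j = k)
    (μ : ℕ → Measure (ℕ → ℕ)) [∀ n, IsProbabilityMeasure (μ n)]
    (hμ : ∀ (n m k : ℕ) (B : Fin k → Set ℕ),
      μ n {ω | ω 0 = m ∧ ∀ i : Fin k, ω (i + 1) ∈ B i} =
        ENNReal.ofReal (p m n) * μ (next m n) {ω | ∀ i : Fin k, ω i ∈ B i}) :
    IsInfiniteComposition I.map (diagPOVM e μ) := by
  intro k B hB
  rw [diagPOVM_apply e μ (measurableSet_box hB)]
  clear hB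
  induction k with
  | zero =>
    rw [List.ofFn_zero, List.foldr_nil]
    refine op_ext_of_basis e fun i j => ?_
    rw [inner_diagOp_basis, ContinuousLinearMapWOT.one_apply,
      orthonormal_iff_ite.1 e.orthonormal i j]
    simp
  | succ k ih =>
    -- The inner composition is already diagonal by induction, so only one conjugation by the `M_m`,
    -- `m ∈ B 0`, is left to compute.
    rw [List.ofFn_succ, List.foldr_cons, ← ih fun i => B i.succ]
    refine op_ext_of_basis e fun j n => ?_
    refine HasSum.unique ?_ (hasSum_iff_inner.1 (I.hasSum_map (B 0) _) (e j) (e n))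
    simp_rw [fun m => inner_shift_conj e (I.op m) (p m) (hp m) (next m) (hI m) (hinj m) μ]
    rw [inner_diagOp_basis]
    by_cases hjn : j = n
    · simp only [if_pos hjn]
      rw [Complex.hasSum_ofReal]
      set A : Set (ℕ → ℕ) := {ω | ∀ i : Fin k, ω i ∈ B i.succ} with hA
      -- Splitting the box by the first outcome matches the terms of the sum defining the
      -- instrument.
      have hbox : {ω : ℕ → ℕ | ∀ i : Fin (k + 1), ω i ∈ B i} =
          ⋃ m : B 0, {ω : ℕ → ℕ | ω 0 = (m : ℕ) ∧ ∀ i : Fin k, ω (i + 1) ∈ B i.succ} := by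
        ext ω
        simp only [Set.mem_ofPred_eq, Set.mem_iUnion, Fin.forall_fin_succ]
        constructor
        · rintro ⟨h0, h⟩
          exact ⟨⟨ω 0, h0⟩, rfl, h⟩
        · rintro ⟨m, h0, h⟩
          refine ⟨?_, h⟩
          change ω 0 ∈ B 0
          rw [h0]; exact m.2
      have hmeas : ∀ m : B 0, MeasurableSet
          {ω : ℕ → ℕ | ω 0 = (m : ℕ) ∧ ∀ i : Fin k, ω (i + 1) ∈ B i.succ} := fun m => by
        have h := ((measurable_pi_apply (X := fun _ : ℕ => ℕ) 0)
          (MeasurableSet.singleton (m : ℕ))).inter (MeasurableSet.iInter fun i : Fin k =>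
            (measurable_pi_apply (X := fun _ : ℕ => ℕ) (i + 1))
              (MeasurableSet.of_discrete (s := B i.succ)))
        convert h using 1
        ext ω
        simp
      have h := hasSum_measureReal_iUnion (μ n) hmeas fun a b hab => by
        refine Set.disjoint_left.2 fun ω h1 h2 => hab (Subtype.ext (h1.1.symm.trans h2.1))
      rw [← hbox] at h
      convert! h using 2 with m
      rw [measureReal_def (μ n), hμ, ENNReal.toReal_mul, ENNReal.toReal_ofReal (hp m n)]
      rfl
    · simp only [if_neg hjn]
      exact hasSum_zero

end Boxes

theorem measurable_totalCount (k : ℕ) : Measurable (totalCount k) :=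
  Finset.measurable_sum _ fun i _ => measurable_pi_apply i

/-! ### Measurement operators as weighted shifts of the number basis -/

section WeightedShift

variable {H : Type*} [NormedAddCommGroup H] [InnerProductSpace ℂ H] [CompleteSpace H]

theorem pcProb_eq_zero {m n : ℕ} (lam t : ℝ) (h : n < m) : pcProb lam t m n = 0 := by
  rw [pcProb, Nat.choose_eq_zero_of_lt h]; simp

theorem pcOp_apply_basis (e : HilbertBasis ℕ ℂ H) {lam t : ℝ} (hlam : 0 < lam) (ht : 0 < t)
    (m n : ℕ) : pcOp e lam t m (e n) = ((√(pcProb lam t m n) : ℝ) : ℂ) • e (n - m) := by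
  apply e.repr.injective
  ext j
  rw [e.repr_apply_apply, e.repr_apply_apply]
  have he := orthonormal_iff_ite.1 e.orthonormal
  refine (hasSum_inner_ketBra e.orthonormal (orthonormal_shift e m) _
    (fun n => norm_sqrt_le_one (pcProb_le_one hlam ht m (n + m))) (e j) (e n)).unique ?_
  simp only [he, inner_smul_right]
  convert! hasSum_single (f := fun i => ((√(pcProb lam t m (i + m)) : ℝ) : ℂ) *
    ((if j = i then 1 else 0) * (if i + m = n then 1 else 0))) j ?_ using 1
  -- For `n < m` the vector `e (n - m)` is a meaningless `e 0`, but its weight is zero.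
  · rcases lt_or_ge n m with h | h
    · rw [pcProb_eq_zero lam t h, if_neg (by omega : ¬ j + m = n)]
      simp
    · by_cases hj : j + m = n
      · subst hj
        simp
      · simp [hj, show ¬ j = n - m by omega]
  · intro i hi
    simp [hi.symm]

theorem qcOp_apply_basis (e : HilbertBasis ℕ ℂ H) {lam t : ℝ} (hlam : 0 < lam) (ht : 0 < t)
    (m n : ℕ) : qcOp e lam t m (e n) = ((√(qcProb lam t m n) : ℝ) : ℂ) • e (n + m) := by
  apply e.repr.injective
  ext j
  rw [e.repr_apply_apply, e.repr_apply_apply]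
  have he := orthonormal_iff_ite.1 e.orthonormal
  refine (hasSum_inner_ketBra (orthonormal_shift e m) e.orthonormal _
    (fun n => norm_sqrt_le_one (qcProb_le_one hlam ht m n)) (e j) (e n)).unique ?_
  simp only [he, inner_smul_right]
  convert! hasSum_single (f := fun i => ((√(qcProb lam t m i) : ℝ) : ℂ) *
    ((if j = i + m then 1 else 0) * (if i = n then 1 else 0))) n ?_ using 1
  · simp
  · intro i hi
    simp [hi]

end WeightedShift

/-! ### Photon counting as independent geometric absorption times -/

section PhotonCounting

/-- The law of the counts `(m₁, m₂, …)` of the photon counter for `n` initial photons: the photons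
are absorbed independently of each other, at geometrically distributed times. -/
noncomputable def pcLaw (lam t : ℝ) : ℕ → Measure (ℕ → ℕ)
  | 0 => Measure.dirac 0
  | n + 1 => Measure.sum fun i =>
      ENNReal.ofReal ((1 - Real.exp (-(lam * t))) * Real.exp (-(lam * t)) ^ i) •
        (pcLaw lam t n).map fun ω => ω + Pi.single i 1

theorem measurable_add_single (i : ℕ) :
    Measurable fun ω : ℕ → ℕ => ω + Pi.single i 1 :=
  measurable_pi_lambda _ fun j => (measurable_pi_apply j).add_const _

theorem pcLaw_succ_apply (lam t : ℝ) (n : ℕ) {S : Set (ℕ → ℕ)} (hS : MeasurableSet S) :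
    pcLaw lam t (n + 1) S = ∑' i,
      ENNReal.ofReal ((1 - Real.exp (-(lam * t))) * Real.exp (-(lam * t)) ^ i) *
        pcLaw lam t n ((fun ω => ω + Pi.single i 1) ⁻¹' S) := by
  rw [pcLaw, Measure.sum_apply _ hS]
  refine tsum_congr fun i => ?_
  rw [Measure.smul_apply, Measure.map_apply (measurable_add_single i) hS, smul_eq_mul]

theorem isProbabilityMeasure_pcLaw {lam t : ℝ} (hlam : 0 < lam) (ht : 0 < t) (n : ℕ) :
    IsProbabilityMeasure (pcLaw lam t n) := by
  have h1 : Real.exp (-(lam * t)) < 1 := by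
    rw [Real.exp_lt_one_iff]; nlinarith
  induction n with
  | zero => rw [pcLaw]; infer_instance
  | succ n ih =>
    constructor
    rw [pcLaw_succ_apply _ _ _ .univ]
    simp only [Set.preimage_univ, measure_univ, mul_one]
    have h := (hasSum_geometric_of_lt_one (Real.exp_pos _).le h1).mul_left
      (1 - Real.exp (-(lam * t)))
    rw [mul_inv_cancel₀ (by linarith)] at h
    rw [← ENNReal.ofReal_tsum_of_nonneg (fun i => ?_) h.summable, h.tsum_eq, ENNReal.ofReal_one]
    exact mul_nonneg (by linarith) (by positivity)

/-- Splitting the exponential into natural powers avoids `n - m` and stays valid for `m > n`, so the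
recursions in `n` become polynomial identities. -/
theorem pcProb_eq (lam t : ℝ) (m n : ℕ) :
    pcProb lam t m n = n.choose m * (1 - Real.exp (-(lam * t))) ^ m *
      Real.exp (-(lam * t)) ^ n * Real.exp (lam * t) ^ m := by
  rw [pcProb, mul_assoc _ (Real.exp (-(lam * t)) ^ n), ← Real.exp_nat_mul, ← Real.exp_nat_mul,
    ← Real.exp_add]
  ring_nf

theorem pcProb_zero_succ (lam t : ℝ) (n : ℕ) :
    pcProb lam t 0 (n + 1) = Real.exp (-(lam * t)) * pcProb lam t 0 n := by
  simp only [pcProb_eq, pow_succ]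
  simp [mul_comm]

/-- Pascal's rule: one distinguished photon is either absorbed in the first interval or survives it.
-/
theorem pcProb_succ_succ (lam t : ℝ) (m n : ℕ) :
    pcProb lam t (m + 1) (n + 1) = (1 - Real.exp (-(lam * t))) * pcProb lam t m n +
      Real.exp (-(lam * t)) * pcProb lam t (m + 1) n := by
  have h : Real.exp (-(lam * t)) * Real.exp (lam * t) = 1 := by rw [← Real.exp_add]; simp
  simp only [pcProb_eq, pow_succ, Nat.choose_succ_succ, Nat.cast_add]
  linear_combination (n.choose m : ℝ) * (1 - Real.exp (-(lam * t))) ^ m *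
    (1 - Real.exp (-(lam * t))) * Real.exp (-(lam * t)) ^ n * Real.exp (lam * t) ^ m * h

theorem measurableSet_first_and_shift (m : ℕ) {A : Set (ℕ → ℕ)} (hA : MeasurableSet A) :
    MeasurableSet {ω : ℕ → ℕ | ω 0 = m ∧ (fun i => ω (i + 1)) ∈ A} := by
  have h1 : Measurable fun ω : ℕ → ℕ => ω 0 := measurable_pi_apply 0
  have h2 : Measurable fun (ω : ℕ → ℕ) (i : ℕ) => ω (i + 1) :=
    measurable_pi_lambda _ fun i => measurable_pi_apply (i + 1)
  exact (h1 (MeasurableSet.singleton m)).inter (h2 hA)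

/-- The Markov property of the photon counter. -/
theorem pcLaw_markov {lam t : ℝ} (hlam : 0 < lam) (ht : 0 < t) (n m : ℕ) {A : Set (ℕ → ℕ)}
    (hA : MeasurableSet A) :
    pcLaw lam t n {ω | ω 0 = m ∧ (fun i => ω (i + 1)) ∈ A} =
      ENNReal.ofReal (pcProb lam t m n) * pcLaw lam t (n - m) A := by
  induction n generalizing m A with
  | zero =>
    rcases m with _ | m
    · rw [pcLaw, Measure.dirac_apply' _ (measurableSet_first_and_shift 0 hA),
        Measure.dirac_apply' _ hA]
      have : (0 : ℕ → ℕ) ∈ {ω : ℕ → ℕ | ω 0 = 0 ∧ (fun i => ω (i + 1)) ∈ A} ↔ (0 : ℕ → ℕ) ∈ A := by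
        simp [Pi.zero_def]
      by_cases h : (0 : ℕ → ℕ) ∈ A
      · rw [Set.indicator_of_mem (this.2 h), Set.indicator_of_mem h]
        simp [pcProb]
      · rw [Set.indicator_of_notMem (mt this.1 h), Set.indicator_of_notMem h, mul_zero]
    · rw [pcProb_eq_zero _ _ (Nat.succ_pos m), pcLaw,
        Measure.dirac_apply' _ (measurableSet_first_and_shift _ hA)]
      simp
  | succ n ih =>
    set q := Real.exp (-(lam * t)) with hq
    have hq0 : 0 ≤ q := (Real.exp_pos _).le
    have hq1 : 0 ≤ 1 - q := by
      rw [sub_nonneg, hq, Real.exp_le_one_iff]; nlinarith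
    -- The added photon survives the first interval, which costs a factor `q`. Its remaining waiting
    -- time is again geometric, so it joins the photons left over from the other `n`.
    have htail : ∑' i, ENNReal.ofReal ((1 - q) * q ^ (i + 1)) *
        pcLaw lam t n ((fun ω => ω + Pi.single (i + 1) 1) ⁻¹'
          {ω | ω 0 = m ∧ (fun i => ω (i + 1)) ∈ A}) =
        ENNReal.ofReal (q * pcProb lam t m n) * pcLaw lam t (n + 1 - m) A := by
      have hset : ∀ i : ℕ, (fun ω : ℕ → ℕ => ω + Pi.single (i + 1) 1) ⁻¹'
          {ω | ω 0 = m ∧ (fun i => ω (i + 1)) ∈ A} =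
          {ω | ω 0 = m ∧ (fun i => ω (i + 1)) ∈ (fun ω : ℕ → ℕ => ω + Pi.single i 1) ⁻¹' A} := by
        intro i
        ext ω
        have : (fun j => ω (j + 1) + (Pi.single (i + 1) 1 : ℕ → ℕ) (j + 1)) =
            (fun j => ω (j + 1)) + (Pi.single i 1 : ℕ → ℕ) := by
          ext j
          simp [Pi.single_apply]
        simp [this]
      -- If `n < m`, the truncated differences do not match, but both sides carry the weight zero.
      simp_rw [hset, fun i => ih m (measurable_add_single i hA)]
      rcases lt_or_ge n m with h | h
      · simp [pcProb_eq_zero _ _ h]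
      · rw [Nat.succ_sub h, pcLaw_succ_apply _ _ _ hA, ← hq, ← ENNReal.tsum_mul_left]
        refine tsum_congr fun i => ?_
        rw [pow_succ, ← mul_assoc (1 - q), ENNReal.ofReal_mul (by positivity : 0 ≤ (1 - q) * q ^ i),
          ENNReal.ofReal_mul hq0]
        ring
    -- The term `i = 0`, absorption in the first interval, is separated from the tail. It
    -- contributes nothing to a first count of zero.
    rw [pcLaw_succ_apply _ _ _ (measurableSet_first_and_shift _ hA),
      tsum_eq_zero_add' ENNReal.summable, htail, pow_zero, mul_one]
    rcases m with _ | m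
    · have h0 : (fun ω : ℕ → ℕ => ω + Pi.single 0 1) ⁻¹'
          {ω | ω 0 = 0 ∧ (fun i => ω (i + 1)) ∈ A} = ∅ := by
        ext ω; simp
      rw [h0, measure_empty, mul_zero, zero_add, pcProb_zero_succ]
    · have h0 : (fun ω : ℕ → ℕ => ω + Pi.single 0 1) ⁻¹'
          {ω | ω 0 = m + 1 ∧ (fun i => ω (i + 1)) ∈ A} =
          {ω | ω 0 = m ∧ (fun i => ω (i + 1)) ∈ A} := by
        ext ω; simp
      rw [h0, ih m hA, Nat.succ_sub_succ, ← mul_assoc, ← ENNReal.ofReal_mul hq1, ← add_mul,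
        ← ENNReal.ofReal_add (mul_nonneg hq1 (pcProb_nonneg hlam ht _ _))
          (mul_nonneg hq0 (pcProb_nonneg hlam ht _ _)), pcProb_succ_succ]

theorem measurableSet_eventually_totalCount (n : ℕ) :
    MeasurableSet {ω : ℕ → ℕ | ∀ᶠ k in atTop, totalCount k ω = n} := by
  simp_rw [eventually_atTop, Set.ofPred_exists, Set.ofPred_forall]
  exact MeasurableSet.iUnion fun K => MeasurableSet.iInter fun k => MeasurableSet.iInter fun _ =>
    measurable_totalCount k (MeasurableSet.singleton n)

/-- The added photon has a finite absorption time `i`, so it adds exactly one to every total count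
with `k > i`. -/
theorem ae_pcLaw_eventually_totalCount (lam t : ℝ) (n : ℕ) :
    ∀ᵐ ω ∂pcLaw lam t n, ∀ᶠ k in atTop, totalCount k ω = n := by
  induction n with
  | zero =>
    rw [pcLaw, ae_dirac_iff (measurableSet_eventually_totalCount 0)]
    simp [totalCount]
  | succ n ih =>
    rw [pcLaw, Measure.ae_sum_iff]
    intro i
    refine Measure.ae_smul_measure ?_ _
    rw [ae_map_iff (measurable_add_single i).aemeasurable (measurableSet_eventually_totalCount _)]
    filter_upwards [ih] with ω hω
    filter_upwards [hω, eventually_gt_atTop i] with k hk hik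
    rw [← hk]
    simp [totalCount, Finset.sum_add_distrib, hik]

end PhotonCounting

open ProbabilityTheory
open scoped NNReal

/-! ### Mean and variance of the Poisson law, and its measurability in the parameter -/

section Poisson

theorem measurable_poissonMeasure : Measurable poissonMeasure := by
  refine Measure.measurable_of_measurable_coe _ fun S hS => ?_
  simp only [poissonMeasure, Measure.sum_apply _ hS, Measure.smul_apply, smul_eq_mul]
  exact Measurable.tsum fun n => by fun_prop

/-- This index shift yields the first two moments: the term `n = 0` vanishes, and each factor `n` is
traded for a factor `r`. -/
theorem poisson_weight_succ (r : ℝ) (n : ℕ) :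
    Real.exp (-r) * r ^ (n + 1) / (n + 1).factorial * ((n + 1 : ℕ) : ℝ) =
      r * (Real.exp (-r) * r ^ n / n.factorial) := by
  rw [Nat.factorial_succ]
  push_cast
  field_simp
  ring

theorem hasSum_poisson_id (r : ℝ≥0) :
    HasSum (fun n : ℕ => Real.exp (-r) * r ^ n / n.factorial * (n : ℝ)) r := by
  have h := (hasSum_one_poissonMeasure r).mul_left (r : ℝ)
  rw [← hasSum_nat_add_iff' 1]
  simp_rw [poisson_weight_succ]
  simpa using h

theorem hasSum_poisson_sq (r : ℝ≥0) :
    HasSum (fun n : ℕ => Real.exp (-r) * r ^ n / n.factorial * (n : ℝ) ^ 2) (r * (r + 1)) := by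
  have h := ((hasSum_poisson_id r).add (hasSum_one_poissonMeasure r)).mul_left (r : ℝ)
  rw [← hasSum_nat_add_iff' 1]
  simp_rw [sq, ← mul_assoc, poisson_weight_succ]
  have he : ∀ n : ℕ, r * (Real.exp (-r) * r ^ n / n.factorial) * ((n + 1 : ℕ) : ℝ) =
      r * (Real.exp (-r) * r ^ n / n.factorial * n + Real.exp (-r) * r ^ n / n.factorial) :=
    fun n => by push_cast; ring
  simp_rw [he]
  simpa using h

theorem integrable_sq_poisson (r : ℝ≥0) :
    Integrable (fun n : ℕ => (n : ℝ) ^ 2) (poissonMeasure r) := by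
  rw [integrable_poissonMeasure_iff]
  simpa using (hasSum_poisson_sq r).summable

theorem memLp_poisson (r : ℝ≥0) : MemLp (fun n : ℕ => (n : ℝ)) 2 (poissonMeasure r) :=
  (memLp_two_iff_integrable_sq (Measurable.of_discrete).aestronglyMeasurable).2
    (integrable_sq_poisson r)

theorem integral_poisson (r : ℝ≥0) : ∫ n : ℕ, (n : ℝ) ∂poissonMeasure r = r := by
  rw [integral_poissonMeasure]
  exact (hasSum_poisson_id r).tsum_eq

theorem variance_poisson (r : ℝ≥0) : variance (fun n : ℕ => (n : ℝ)) (poissonMeasure r) = r := by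
  rw [variance_eq_sub (memLp_poisson r), integral_poisson]
  have h : ∫ n : ℕ, ((fun n : ℕ => (n : ℝ)) ^ 2) n ∂poissonMeasure r = r * (r + 1) := by
    rw [integral_poissonMeasure]
    exact (hasSum_poisson_sq r).tsum_eq
  rw [h]; ring

end Poisson

/-! ### Independent Poisson counts with exponentially growing means -/

section PoissonClicks

/-- The mean of the `i`-th count of the quantum counter, given the limit `x` of the normalized
counts. -/
noncomputable def clickRate (s x : ℝ) (i : ℕ) : ℝ≥0 :=
  (x * (Real.exp (s * i) * (Real.exp s - 1))).toNNReal

theorem coe_clickRate {s x : ℝ} (hs : 0 < s) (hx : 0 < x) (i : ℕ) :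
    (clickRate s x i : ℝ) = x * (Real.exp (s * i) * (Real.exp s - 1)) := by
  have h : 0 ≤ Real.exp s - 1 := by rw [sub_nonneg, Real.one_le_exp_iff]; exact hs.le
  exact Real.coe_toNNReal _ (by positivity)

theorem sum_clickRate {s x : ℝ} (hs : 0 < s) (hx : 0 < x) (k : ℕ) :
    ∑ i ∈ Finset.range k, (clickRate s x i : ℝ) = x * (Real.exp (s * k) - 1) := by
  induction k with
  | zero => simp
  | succ k ih =>
    rw [Finset.sum_range_succ, ih, coe_clickRate hs hx, Nat.cast_succ, mul_add, mul_one,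
      Real.exp_add]
    ring

/-- The law of independent Poisson counts with the means `clickRate s x i`. -/
noncomputable def poissonClicks (s x : ℝ) : Measure (ℕ → ℕ) :=
  Measure.infinitePi fun i => poissonMeasure (clickRate s x i)

instance (s x : ℝ) : IsProbabilityMeasure (poissonClicks s x) := by
  unfold poissonClicks; infer_instance

theorem poissonClicks_box (s x : ℝ) {k : ℕ} (B : Fin k → Set ℕ) :
    poissonClicks s x {ω | ∀ i : Fin k, ω i ∈ B i} =
      ∏ i : Fin k, poissonMeasure (clickRate s x i) (B i) := by
  have h := Measure.infinitePi_pi (fun i => poissonMeasure (clickRate s x i))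
    (s := Finset.range k) (t := fun i => if h : i < k then B ⟨i, h⟩ else Set.univ)
    fun _ _ => .of_discrete
  rw [Finset.prod_range] at h
  simp only [Fin.is_lt, dif_pos, Fin.eta] at h
  rw [← h, poissonClicks]
  congr 1
  ext ω
  simp only [Set.mem_ofPred_eq, Set.mem_pi, Finset.coe_range, Set.mem_Iio]
  constructor
  · intro h i hi
    rw [dif_pos hi]
    exact h ⟨i, hi⟩
  · intro h i
    have := h i i.2
    rwa [dif_pos i.2] at this

/-- Measurability in `x` is what permits mixing these laws over a random `x`. On boxes it reduces to
finite products of Poisson probabilities. -/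
theorem measurable_poissonClicks (s : ℝ) : Measurable (poissonClicks s) := by
  refine Measurable.measure_of_isPiSystem_of_isProbabilityMeasure generateFrom_boxes
    isPiSystem_boxes ?_
  rintro _ ⟨k, B, -, rfl⟩
  simp_rw [poissonClicks_box]
  refine Finset.measurable_prod _ fun i _ => ?_
  have h : Measurable fun x => clickRate s x i := by unfold clickRate; fun_prop
  exact (Measure.measurable_coe .of_discrete).comp (measurable_poissonMeasure.comp h)

/-- Self-similarity: dropping the first count amounts to replacing `x` by `x e^s`. -/
theorem clickRate_succ (s x : ℝ) (i : ℕ) :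
    clickRate s x (i + 1) = clickRate s (x * Real.exp s) i := by
  rw [clickRate, clickRate, Nat.cast_succ, mul_add, mul_one, Real.exp_add]
  congr 1
  ring

theorem poissonClicks_markov (s x : ℝ) (m : ℕ) {k : ℕ} (B : Fin k → Set ℕ) :
    poissonClicks s x {ω | ω 0 = m ∧ ∀ i : Fin k, ω (i + 1) ∈ B i} =
      poissonMeasure (clickRate s x 0) {m} *
        poissonClicks s (x * Real.exp s) {ω | ∀ i : Fin k, ω i ∈ B i} := by
  have h := poissonClicks_box s x (Fin.cons {m} B : Fin (k + 1) → Set ℕ)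
  rw [Fin.prod_univ_succ] at h
  simp only [Fin.cons_zero, Fin.cons_succ, Fin.val_zero, Fin.val_succ, clickRate_succ] at h
  rw [poissonClicks_box, ← h]
  congr 1
  ext ω
  simp [Fin.forall_fin_succ]

theorem measurePreserving_eval_poissonClicks (s x : ℝ) (i : ℕ) :
    MeasurePreserving (fun ω : ℕ → ℕ => ω i) (poissonClicks s x)
      (poissonMeasure (clickRate s x i)) :=
  measurePreserving_eval_infinitePi (fun i => poissonMeasure (clickRate s x i)) i

theorem memLp_eval_poissonClicks (s x : ℝ) (i : ℕ) :
    MemLp (fun ω : ℕ → ℕ => (ω i : ℝ)) 2 (poissonClicks s x) :=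
  (memLp_poisson _).comp_measurePreserving (measurePreserving_eval_poissonClicks s x i)

theorem totalCount_cast (k : ℕ) :
    (fun ω => (totalCount k ω : ℝ)) = ∑ i ∈ Finset.range k, fun ω : ℕ → ℕ => (ω i : ℝ) := by
  ext ω
  simp [totalCount]

theorem memLp_totalCount (s x : ℝ) (k : ℕ) :
    MemLp (fun ω => (totalCount k ω : ℝ)) 2 (poissonClicks s x) := by
  rw [totalCount_cast]
  exact memLp_finsetSum' _ fun i _ => memLp_eval_poissonClicks s x i

theorem integral_totalCount {s x : ℝ} (hs : 0 < s) (hx : 0 < x) (k : ℕ) :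
    ∫ ω, (totalCount k ω : ℝ) ∂poissonClicks s x = x * (Real.exp (s * k) - 1) := by
  rw [← sum_clickRate hs hx]
  simp_rw [totalCount, Nat.cast_sum]
  rw [integral_finsetSum _ fun i _ => (memLp_eval_poissonClicks s x i).integrable (by norm_num)]
  refine Finset.sum_congr rfl fun i _ => ?_
  rw [← integral_poisson, ← (measurePreserving_eval_poissonClicks s x i).map_eq,
    integral_map (measurable_pi_apply i).aemeasurable
      (Measurable.of_discrete).aestronglyMeasurable]

theorem variance_totalCount {s x : ℝ} (hs : 0 < s) (hx : 0 < x) (k : ℕ) :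
    variance (fun ω => (totalCount k ω : ℝ)) (poissonClicks s x) =
      x * (Real.exp (s * k) - 1) := by
  rw [← sum_clickRate hs hx, totalCount_cast,
    IndepFun.variance_sum (fun i _ => memLp_eval_poissonClicks s x i)]
  · refine Finset.sum_congr rfl fun i _ => ?_
    rw [(measurePreserving_eval_poissonClicks s x i).variance_fun_comp
      (f := fun n : ℕ => (n : ℝ)) (Measurable.of_discrete).aemeasurable, variance_poisson]
  · intro i _ j _ hij
    exact (iIndepFun_infinitePi (P := fun i => poissonMeasure (clickRate s x i))
      (X := fun _ (n : ℕ) => (n : ℝ)) fun _ => .of_discrete).indepFun hij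

theorem ae_poissonClicks_tendsto {lam t : ℝ} (hs : 0 < lam * t) {x : ℝ} (hx : 0 < x) :
    ∀ᵐ ω ∂poissonClicks (lam * t) x,
      Tendsto (fun k => normalizedCount lam t k ω) atTop (𝓝 x) := by
  set s := lam * t with hs_def
  have hq : Real.exp (-(s / 4)) < 1 := by rw [Real.exp_lt_one_iff]; linarith
  have hq2 : Real.exp (-(s / 2)) < 1 := by rw [Real.exp_lt_one_iff]; linarith
  -- With threshold `e^{sk} e^{-sk/4}` Chebyshev gives at most `x e^{sk} / (e^{2sk} e^{-sk/2}) = x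
  -- e^{-sk/2}`, which is summable, while the threshold divided by `e^{sk}` still tends to zero.
  have hcheb : ∀ k : ℕ, poissonClicks s x {ω | Real.exp (s * k) * Real.exp (-(s / 4)) ^ k ≤
      |(totalCount k ω : ℝ) - x * (Real.exp (s * k) - 1)|} ≤
      ENNReal.ofReal (x * Real.exp (-(s / 2)) ^ k) := by
    intro k
    have h := meas_ge_le_variance_div_sq (memLp_totalCount s x k)
      (c := Real.exp (s * k) * Real.exp (-(s / 4)) ^ k) (by positivity)
    rw [integral_totalCount hs hx, variance_totalCount hs hx] at h
    refine h.trans (ENNReal.ofReal_le_ofReal ?_)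
    rw [div_le_iff₀ (by positivity)]
    have he : x * Real.exp (-(s / 2)) ^ k * (Real.exp (s * k) * Real.exp (-(s / 4)) ^ k) ^ 2 =
        x * Real.exp (s * k) := by
      rw [mul_assoc, ← Real.exp_nat_mul, ← Real.exp_nat_mul, ← Real.exp_add, ← Real.exp_nat_mul,
        ← Real.exp_add]
      congr 2
      push_cast
      ring
    rw [he]
    nlinarith
  have hsum : ∑' k : ℕ, poissonClicks s x {ω | Real.exp (s * k) * Real.exp (-(s / 4)) ^ k ≤
      |(totalCount k ω : ℝ) - x * (Real.exp (s * k) - 1)|} ≠ ⊤ := by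
    refine ne_top_of_le_ne_top ?_ (ENNReal.tsum_le_tsum hcheb)
    rw [← ENNReal.ofReal_tsum_of_nonneg (fun k => by positivity)
      ((summable_geometric_of_lt_one (Real.exp_pos _).le hq2).mul_left x)]
    exact ENNReal.ofReal_ne_top
  filter_upwards [ae_eventually_notMem hsum] with ω hω
  have hz : Tendsto (fun k : ℕ => Real.exp (-(s / 4)) ^ k + x * Real.exp (-s) ^ k) atTop (𝓝 0) := by
    have h1 := tendsto_pow_atTop_nhds_zero_of_lt_one (Real.exp_pos _).le hq
    have h2 := tendsto_pow_atTop_nhds_zero_of_lt_one (Real.exp_pos (-s)).le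
      (by rw [Real.exp_lt_one_iff]; linarith)
    simpa using h1.add (h2.const_mul x)
  rw [tendsto_iff_norm_sub_tendsto_zero]
  refine tendsto_of_tendsto_of_tendsto_of_le_of_le' tendsto_const_nhds hz
    (Eventually.of_forall fun k => norm_nonneg _) ?_
  filter_upwards [hω] with k hk
  simp only [not_le] at hk
  have hinv : Real.exp (-(s * k)) * Real.exp (s * k) = 1 := by rw [← Real.exp_add]; simp
  have hpow : Real.exp (-s) ^ k = Real.exp (-(s * k)) := by
    rw [← Real.exp_nat_mul]; congr 1; ring
  -- The error is the rescaled deviation from the mean, minus the bias `x e^{-sk}` due to the `-1`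
  -- in the mean.
  have heq : normalizedCount lam t k ω - x = Real.exp (-(s * k)) *
      ((totalCount k ω : ℝ) - x * (Real.exp (s * k) - 1)) - x * Real.exp (-(s * k)) := by
    rw [normalizedCount]
    linear_combination (x : ℝ) * hinv
  rw [heq, hpow, Real.norm_eq_abs]
  refine (abs_sub _ _).trans (add_le_add ?_ ?_)
  · rw [abs_mul, abs_of_pos (Real.exp_pos _)]
    refine (mul_le_mul_of_nonneg_left hk.le (Real.exp_pos _).le).trans ?_
    rw [← mul_assoc, hinv, one_mul]
  · rw [abs_of_pos (by positivity)]

end PoissonClicks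

/-! ### The quantum counter as a Gamma mixture of Poisson counts -/

section QuantumCounter

/-- The Gamma distribution with density `e^{-x} xⁿ / n!` on the half-line. -/
noncomputable def gammaLaw (n : ℕ) : Measure (Set.Ioi (0 : ℝ)) :=
  halfLine.withDensity fun x => ENNReal.ofReal (Real.exp (-(x : ℝ)) * (x : ℝ) ^ n / n.factorial)

instance (n : ℕ) : IsProbabilityMeasure (gammaLaw n) := by
  constructor
  rw [gammaLaw, withDensity_apply _ .univ, Measure.restrict_univ, lintegral_poisson]

/-- The law of the counts `(m₁, m₂, …)` of the quantum counter for `n` initial photons: a Gamma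
mixture of independent Poisson counts. -/
noncomputable def qcLaw (s : ℝ) (n : ℕ) : Measure (ℕ → ℕ) :=
  (gammaLaw n).bind fun x => poissonClicks s x

theorem measurable_poissonClicks_coe (s : ℝ) :
    Measurable fun x : Set.Ioi (0 : ℝ) => poissonClicks s x :=
  (measurable_poissonClicks s).comp measurable_subtype_coe

theorem qcLaw_apply (s : ℝ) (n : ℕ) {S : Set (ℕ → ℕ)} (hS : MeasurableSet S) :
    qcLaw s n S = ∫⁻ x, poissonClicks s x S ∂gammaLaw n :=
  Measure.bind_apply hS (measurable_poissonClicks_coe s).aemeasurable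

instance (s : ℝ) (n : ℕ) : IsProbabilityMeasure (qcLaw s n) := by
  constructor
  rw [qcLaw_apply s n .univ]
  simp

theorem measurable_poissonClicks_apply (s : ℝ) {S : Set (ℕ → ℕ)} (hS : MeasurableSet S) :
    Measurable fun x => poissonClicks s x S :=
  (Measure.measurable_coe hS).comp (measurable_poissonClicks s)

theorem measurable_poissonClicks_apply_coe (s : ℝ) {S : Set (ℕ → ℕ)} (hS : MeasurableSet S) :
    Measurable fun x : Set.Ioi (0 : ℝ) => poissonClicks s x S :=
  (measurable_poissonClicks_apply s hS).comp measurable_subtype_coe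

theorem qcLaw_apply_eq_setLIntegral (s : ℝ) (n : ℕ) {S : Set (ℕ → ℕ)} (hS : MeasurableSet S) :
    qcLaw s n S = ∫⁻ x in Set.Ioi (0 : ℝ),
      ENNReal.ofReal (Real.exp (-x) * x ^ n / n.factorial) * poissonClicks s x S := by
  rw [qcLaw_apply s n hS, gammaLaw, lintegral_withDensity_eq_lintegral_mul _ (by fun_prop)
    (measurable_poissonClicks_apply_coe s hS)]
  exact lintegral_subtype_comap measurableSet_Ioi
    fun x => ENNReal.ofReal (Real.exp (-x) * x ^ n / n.factorial) * poissonClicks s x S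

theorem setLIntegral_Ioi_comp_mul {a : ℝ} (ha : 0 < a) {f : ℝ → ENNReal} (hf : Measurable f) :
    ∫⁻ x in Set.Ioi (0 : ℝ), ENNReal.ofReal a * f (x * a) = ∫⁻ x in Set.Ioi (0 : ℝ), f x := by
  have h := Real.smul_map_volume_mul_right ha.ne'
  rw [abs_of_pos ha] at h
  conv_rhs => rw [← lintegral_indicator measurableSet_Ioi, ← h]
  have hm : Measurable fun x => (Set.Ioi (0 : ℝ)).indicator f (x * a) :=
    (hf.indicator measurableSet_Ioi).comp (measurable_mul_const a)
  rw [lintegral_smul_measure, lintegral_map (hf.indicator measurableSet_Ioi) (by fun_prop),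
    ← lintegral_indicator measurableSet_Ioi, smul_eq_mul,
    ← lintegral_const_mul _ hm]
  refine lintegral_congr fun x => ?_
  simp only [Set.indicator_apply, Set.mem_Ioi, mul_pos_iff_of_pos_right ha]
  split_ifs <;> simp

/-- Gamma–Poisson conjugacy: the left side is the joint density of `x` and the first count `m`. It
factors into the marginal weight of `m` and the posterior density, which is the Gamma density of
index `n + m` in the variable `x e^s`, with Jacobian `e^s`. -/
theorem gamma_mul_poisson_weight {lam t x : ℝ} (hs : 0 < lam * t) (hx : 0 < x) (n m : ℕ) :
    Real.exp (-x) * x ^ n / n.factorial *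
      (Real.exp (-(clickRate (lam * t) x 0 : ℝ)) * (clickRate (lam * t) x 0 : ℝ) ^ m /
        m.factorial) =
    qcProb lam t m n * (Real.exp (lam * t) * (Real.exp (-(x * Real.exp (lam * t))) *
      (x * Real.exp (lam * t)) ^ (n + m) / (n + m).factorial)) := by
  rw [coe_clickRate hs hx, qcProb]
  set E := Real.exp (lam * t) with hE
  -- The exponential in `qcProb` cancels the Jacobian together with the `n + m` factors `e^s` of the
  -- rescaled power.
  have h1 : Real.exp (-(lam * t * ((n : ℝ) + m + 1))) * (E * E ^ (n + m)) = 1 := by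
    rw [hE, ← pow_succ', ← Real.exp_nat_mul, ← Real.exp_add, Real.exp_eq_one_iff]
    push_cast; ring
  have h2 : Real.exp (-x) * Real.exp (-(x * (E - 1))) = Real.exp (-(x * E)) := by
    rw [← Real.exp_add]; congr 1; ring
  have h3 : ((n + m).choose m : ℝ) * (n.factorial * m.factorial) = (n + m).factorial := by
    have := Nat.add_choose_mul_factorial_mul_factorial n m
    rw [← this]
    push_cast; ring
  simp only [CharP.cast_eq_zero, mul_zero, Real.exp_zero, one_mul]
  rw [mul_pow x E, ← h2, ← h3]
  have hc : ((n + m).choose m : ℝ) ≠ 0 := by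
    exact_mod_cast (Nat.choose_pos (Nat.le_add_left m n)).ne'
  field_simp
  rw [mul_pow, pow_add x]
  linear_combination (-(x ^ n * x ^ m * (E - 1) ^ m)) * h1

/-- The Markov property of the quantum counter. -/
theorem qcLaw_markov {lam t : ℝ} (hlam : 0 < lam) (ht : 0 < t) (n m : ℕ) {k : ℕ}
    (B : Fin k → Set ℕ) :
    qcLaw (lam * t) n {ω | ω 0 = m ∧ ∀ i : Fin k, ω (i + 1) ∈ B i} =
      ENNReal.ofReal (qcProb lam t m n) *
        qcLaw (lam * t) (n + m) {ω | ∀ i : Fin k, ω i ∈ B i} := by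
  have hs : 0 < lam * t := mul_pos hlam ht
  have hB := measurableSet_box (B := B) fun _ => .of_discrete
  have hmeas := measurable_poissonClicks_apply (lam * t) hB
  have hf : Measurable fun x : ℝ =>
      ENNReal.ofReal (Real.exp (-x) * x ^ (n + m) / (n + m).factorial) *
        poissonClicks (lam * t) x {ω | ∀ i : Fin k, ω i ∈ B i} := by fun_prop
  have hf' := (hf.comp (measurable_mul_const (Real.exp (lam * t)))).const_mul
    (ENNReal.ofReal (Real.exp (lam * t)))
  simp only [Function.comp_apply] at hf'
  have hB' : MeasurableSet {ω : ℕ → ℕ | ω 0 = m ∧ ∀ i : Fin k, ω (i + 1) ∈ B i} :=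
    measurableSet_first_and_shift m hB
  -- The substitution `x ↦ x e^s` on the right brings both sides to the same conditional law of the
  -- later counts, leaving the pointwise identity of weights.
  rw [qcLaw_apply_eq_setLIntegral _ _ hB, qcLaw_apply_eq_setLIntegral _ _ hB',
    ← setLIntegral_Ioi_comp_mul (Real.exp_pos (lam * t)) hf, ← lintegral_const_mul _ hf']
  refine setLIntegral_congr_fun measurableSet_Ioi fun x hx => ?_
  have hx : 0 < x := hx
  have hq := qcProb_nonneg hlam ht m n
  have hw := gamma_mul_poisson_weight hs hx n m
  rw [poissonClicks_markov, poissonMeasure_singleton, ← mul_assoc, ← mul_assoc, ← mul_assoc,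
    ← ENNReal.ofReal_mul (by positivity), ← ENNReal.ofReal_mul hq,
    ← ENNReal.ofReal_mul (by positivity), hw, mul_assoc (qcProb lam t m n)]

theorem ae_qcLaw_iff (s : ℝ) (n : ℕ) {P : (ℕ → ℕ) → Prop} (hP : MeasurableSet {ω | P ω}) :
    (∀ᵐ ω ∂qcLaw s n, P ω) ↔
      ∀ᵐ x : Set.Ioi (0 : ℝ) ∂gammaLaw n, ∀ᵐ ω ∂poissonClicks s x, P ω := by
  rw [ae_iff]
  change qcLaw s n {ω | P ω}ᶜ = 0 ↔ _
  rw [qcLaw_apply s n hP.compl, lintegral_eq_zero_iff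
    (measurable_poissonClicks_apply_coe s hP.compl)]
  rfl

theorem measurable_normalizedCount (lam t : ℝ) (k : ℕ) : Measurable (normalizedCount lam t k) :=
  (Measurable.of_discrete.comp (measurable_totalCount k)).const_mul _

theorem ae_qcLaw_exists_tendsto {lam t : ℝ} (hs : 0 < lam * t) (n : ℕ) :
    ∀ᵐ ω ∂qcLaw (lam * t) n,
      ∃ x : ℝ, Tendsto (fun k => normalizedCount lam t k ω) atTop (𝓝 x) := by
  rw [ae_qcLaw_iff _ _ (measurableSet_exists_tendsto (measurable_normalizedCount lam t))]
  refine ae_of_all _ fun x => ?_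
  filter_upwards [ae_poissonClicks_tendsto hs x.2] with ω hω
  exact ⟨x, hω⟩

/-- Given the mixing parameter `x`, the normalized counts converge to `x`; uniqueness of limits then
makes any limit variable recover the parameter. -/
theorem ae_eq_of_tendsto {lam t : ℝ} (hs : 0 < lam * t) (n : ℕ) {L : (ℕ → ℕ) → ℝ}
    (hL : ∀ᵐ ω ∂qcLaw (lam * t) n,
      Tendsto (fun k => normalizedCount lam t k ω) atTop (𝓝 (L ω))) :
    ∀ᵐ x : Set.Ioi (0 : ℝ) ∂gammaLaw n, ∀ᵐ ω ∂poissonClicks (lam * t) x, L ω = x := by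
  filter_upwards [Measure.ae_ae_of_ae_bind (measurable_poissonClicks_coe _).aemeasurable hL]
    with x hx
  filter_upwards [hx, ae_poissonClicks_tendsto hs x.2] with ω h1 h2
  exact tendsto_nhds_unique h1 h2

theorem exists_measurable_pos_limit {lam t : ℝ} (hs : 0 < lam * t) :
    ∃ L : (ℕ → ℕ) → Set.Ioi (0 : ℝ), Measurable L ∧ ∀ n, ∀ᵐ ω ∂qcLaw (lam * t) n,
      Tendsto (fun k => normalizedCount lam t k ω) atTop (𝓝 (L ω : ℝ)) := by
  classical
  obtain ⟨F, hF, hlim⟩ := exists_measurable_limit (fun n => qcLaw (lam * t) n)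
    (normalizedCount lam t) (measurable_normalizedCount lam t) (ae_qcLaw_exists_tendsto hs)
  have hpos : MeasurableSet {ω | 0 < F ω} := measurableSet_lt measurable_const hF
  -- The value `1` is an arbitrary positive default, used only on a set that turns out to be null
  -- for every `n`.
  have hg : ∀ ω, (if 0 < F ω then F ω else 1) ∈ Set.Ioi (0 : ℝ) := fun ω => by
    split_ifs with h
    exacts [h, Set.mem_Ioi.2 one_pos]
  refine ⟨fun ω => ⟨_, hg ω⟩, (hF.ite hpos measurable_const).subtype_mk, fun n => ?_⟩
  · have h1 : ∀ᵐ ω ∂qcLaw (lam * t) n, 0 < F ω := by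
      rw [ae_qcLaw_iff _ _ hpos]
      filter_upwards [ae_eq_of_tendsto hs n (hlim n)] with x hx
      filter_upwards [hx] with ω hω
      rw [hω]; exact x.2
    filter_upwards [hlim n, h1] with ω h2 h3
    rwa [if_pos h3]

theorem map_qcLaw_limit {lam t : ℝ} (hs : 0 < lam * t) (n : ℕ) {L : (ℕ → ℕ) → Set.Ioi (0 : ℝ)}
    (hL : Measurable L) (hlim : ∀ᵐ ω ∂qcLaw (lam * t) n,
      Tendsto (fun k => normalizedCount lam t k ω) atTop (𝓝 (L ω : ℝ))) :
    (qcLaw (lam * t) n).map L = gammaLaw n := by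
  ext B hB
  -- Since `L = x` almost surely given `x`, the conditional probability of `L ∈ B` is the indicator
  -- of `B` at `x`.
  rw [Measure.map_apply hL hB, qcLaw_apply _ _ (hL hB), ← lintegral_indicator_one hB]
  refine lintegral_congr_ae ?_
  filter_upwards [ae_eq_of_tendsto hs n hlim] with x hx
  by_cases hxB : x ∈ B
  · rw [Set.indicator_of_mem hxB, Pi.one_apply, prob_compl_eq_zero_iff (hL hB) |>.1]
    filter_upwards [hx] with ω hω
    simpa [Subtype.ext hω] using hxB
  · rw [Set.indicator_of_notMem hxB]
    refine measure_eq_zero_iff_ae_notMem.2 ?_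
    filter_upwards [hx] with ω hω
    simpa [Subtype.ext hω] using hxB

end QuantumCounter

/-! ### The limit observables as diagonal POVMs -/

section LimitObservables

variable {H : Type*} [NormedAddCommGroup H] [InnerProductSpace ℂ H] [CompleteSpace H]

theorem numberPOVM_eq_diagPOVM (e : HilbertBasis ℕ ℂ H) :
    diagPOVM e (fun n => Measure.dirac n) = numberPOVM e := by
  refine POVM.ext_of_apply fun B hB => ?_
  have hN : numberPOVM e B = ∑' n : B, ketBra (e n) (e n) := rfl
  rw [diagPOVM_apply e _ hB, hN]
  refine op_ext_of_basis e fun j k => ?_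
  rw [inner_diagOp_basis]
  set T : Op H := ∑' n : B, ketBra (e n) (e n)
  have h : HasSum (B.indicator fun n => ⟪e j, e n⟫_ℂ * ⟪e n, e k⟫_ℂ) ⟪e j, T (e k)⟫_ℂ :=
    (hasSum_subtype_iff_indicator (f := fun n => ⟪e j, e n⟫_ℂ * ⟪e n, e k⟫_ℂ)).1
      (hasSum_number e B (e j) (e k))
  refine HasSum.unique ?_ h
  have he := orthonormal_iff_ite.1 e.orthonormal
  convert! hasSum_single (f := B.indicator fun n => ⟪e j, e n⟫_ℂ * ⟪e n, e k⟫_ℂ) k ?_ using 1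
  · by_cases hk : k ∈ B <;> simp [he, hk, measureReal_def]
  · intro n hn
    by_cases hB : n ∈ B <;> simp [he, hn, hB]

theorem inner_poissonOp_basis (e : HilbertBasis ℕ ℂ H) {x : ℝ} (hx : 0 < x) (j k : ℕ) :
    ⟪e j, poissonOp e x (e k)⟫_ℂ =
      if j = k then ((Real.exp (-x) * x ^ k / k.factorial : ℝ) : ℂ) else 0 := by
  refine (hasSum_inner_poissonOp e (e j) (e k) hx).unique ?_
  have he := orthonormal_iff_ite.1 e.orthonormal
  simp only [he]
  convert! hasSum_single (f := fun n : ℕ => ((Real.exp (-x) * x ^ n / n.factorial : ℝ) : ℂ) *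
    ((if j = n then 1 else 0) * (if n = k then 1 else 0))) j ?_ using 1
  · by_cases h : j = k <;> simp [h]
  · intro n hn
    simp [hn.symm]

/-- Matrix entries pass through the weak integral, and the diagonal entries of `F_x` are the
densities of `gammaLaw`. -/
theorem poissonPOVM_eq_diagPOVM (e : HilbertBasis ℕ ℂ H) :
    diagPOVM e gammaLaw = poissonPOVM e := by
  refine POVM.ext_of_apply fun B hB => ?_
  have hP : poissonPOVM e B = weakIntegral (halfLine.restrict B) fun x => poissonOp e x :=
    if_pos hB
  rw [diagPOVM_apply e _ hB, hP]
  refine op_ext_of_basis e fun j k => ?_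
  rw [inner_diagOp_basis, (isWeakIntegral_poissonOp e B (e j) (e k)).2]
  simp_rw [fun x : Set.Ioi (0 : ℝ) => inner_poissonOp_basis e x.2 j k]
  split_ifs with h
  · rw [integral_complex_ofReal, integral_eq_lintegral_of_nonneg_ae
      (ae_of_all _ fun x => poisson_nonneg x.2 k) (Measurable.aestronglyMeasurable (by fun_prop)),
      measureReal_def, gammaLaw, withDensity_apply _ hB]
  · simp

end LimitObservables

end PhotonPOVM

theorem theorem6 {H : Type*} [NormedAddCommGroup H] [InnerProductSpace ℂ H] [CompleteSpace H]
    (e : HilbertBasis ℕ ℂ H) (lam t : ℝ) (hlam : 0 < lam) (ht : 0 < t) :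
    -- (i) photon counting
    ((∃! E : POVM (ℕ → ℕ) H, IsInfiniteComposition (photonCounting e hlam ht).map E) ∧
      ∀ E : POVM (ℕ → ℕ) H, IsInfiniteComposition (photonCounting e hlam ht).map E →
        E.AlmostSurely (fun m => ∃ n : ℕ, Tendsto (fun k => totalCount k m) atTop (𝓝 n)) ∧
        (∃ L : (ℕ → ℕ) → ℕ, Measurable L ∧
          E.AlmostSurely (fun m => Tendsto (fun k => totalCount k m) atTop (𝓝 (L m)))) ∧
        ∀ (L : (ℕ → ℕ) → ℕ) (hL : Measurable L),
          E.AlmostSurely (fun m => Tendsto (fun k => totalCount k m) atTop (𝓝 (L m))) →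
          E.map L hL = numberPOVM e) ∧
    -- (ii) quantum counter
    ((∃! E : POVM (ℕ → ℕ) H, IsInfiniteComposition (quantumCounter e hlam ht).map E) ∧
      ∀ E : POVM (ℕ → ℕ) H, IsInfiniteComposition (quantumCounter e hlam ht).map E →
        E.AlmostSurely
          (fun m => ∃ x : ℝ, Tendsto (fun k => normalizedCount lam t k m) atTop (𝓝 x)) ∧
        (∃ L : (ℕ → ℕ) → Set.Ioi (0 : ℝ), Measurable L ∧
          E.AlmostSurely
            (fun m => Tendsto (fun k => normalizedCount lam t k m) atTop (𝓝 (L m : ℝ)))) ∧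
        ∀ (L : (ℕ → ℕ) → Set.Ioi (0 : ℝ)) (hL : Measurable L),
          E.AlmostSurely
            (fun m => Tendsto (fun k => normalizedCount lam t k m) atTop (𝓝 (L m : ℝ))) →
          E.map L hL = poissonPOVM e) := by
  have hs : 0 < lam * t := mul_pos hlam ht
  have := isProbabilityMeasure_pcLaw hlam ht
  have hpc : IsInfiniteComposition (photonCounting e hlam ht).map (diagPOVM e (pcLaw lam t)) := by
    refine isInfiniteComposition_diagPOVM e _ (pcProb lam t) (pcProb_nonneg hlam ht)
      (fun m n => n - m) (pcOp_apply_basis e hlam ht) (fun m j k hj hk h => ?_) _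
      fun n m k B => pcLaw_markov hlam ht n m (measurableSet_box fun _ => .of_discrete)
    -- A nonzero weight forces `m ≤ j` and `m ≤ k`, where truncated subtraction of `m` is injective.
    have h1 : m ≤ j := not_lt.1 fun h => hj (pcProb_eq_zero lam t h)
    have h2 : m ≤ k := not_lt.1 fun h => hk (pcProb_eq_zero lam t h)
    omega
  have hqc : IsInfiniteComposition (quantumCounter e hlam ht).map
      (diagPOVM e (qcLaw (lam * t))) :=
    isInfiniteComposition_diagPOVM e _ (qcProb lam t) (qcProb_nonneg hlam ht)
      (fun m n => n + m) (qcOp_apply_basis e hlam ht) (fun m j k _ _ h => Nat.add_right_cancel h) _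
      fun n m k B => qcLaw_markov hlam ht n m B
  have hlim : ∀ n, ∀ᵐ ω ∂pcLaw lam t n, Tendsto (fun k => totalCount k ω) atTop (𝓝 n) :=
    fun n => (ae_pcLaw_eventually_totalCount lam t n).mono fun ω hω =>
      tendsto_const_nhds.congr' (hω.mono fun k hk => hk.symm)
  refine ⟨⟨⟨_, hpc, fun F hF => hF.unique hpc⟩, fun E hE => ?_⟩,
    ⟨⟨_, hqc, fun F hF => hF.unique hqc⟩, fun E hE => ?_⟩⟩
  -- By uniqueness `E` is the diagonal POVM, so every claim is about the laws `pcLaw lam t n`.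
  · obtain rfl := hE.unique hpc
    simp_rw [diagPOVM_almostSurely_iff]
    have hex : ∀ n, ∀ᵐ ω ∂pcLaw lam t n, ∃ l : ℕ, Tendsto (fun k => totalCount k ω) atTop (𝓝 l) :=
      fun n => (hlim n).mono fun ω hω => ⟨n, hω⟩
    refine ⟨hex, exists_measurable_limit _ totalCount measurable_totalCount hex, fun L hL h => ?_⟩
    rw [← numberPOVM_eq_diagPOVM]
    refine diagPOVM_map_eq e _ _ hL fun n => ?_
    have hn : L =ᵐ[pcLaw lam t n] fun _ => n := by
      filter_upwards [h n, hlim n] with ω h1 h2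
      exact tendsto_nhds_unique h1 h2
    rw [Measure.map_congr hn, Measure.map_const, measure_univ, one_smul]
  · obtain rfl := hE.unique hqc
    simp_rw [diagPOVM_almostSurely_iff]
    refine ⟨ae_qcLaw_exists_tendsto hs, exists_measurable_pos_limit hs, fun L hL h => ?_⟩
    rw [← poissonPOVM_eq_diagPOVM]
    exact diagPOVM_map_eq e _ _ hL fun n => map_qcLaw_limit hs n hL (h n)
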